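/- Let $(\lambda_n)_{n\in\mathbb Z}$, $(\mu_n)_{n\in\mathbb Z}$ be strictly positive rates and let $\mathcal A=(\mathcal A_{ij})_{i,j\in\mathbb Z}$ be the tridiagonal operator with $\mathcal A_{i,i+1}=\lambda_i$, $\mathcal A_{ii}=-(\lambda_i+\mu_i)$, $\mathcal A_{i,i-1}=\mu_i$. By a transition function of a (possibly infinite) rate matrix $q$ we mean a family of matrices $P(t)=(P_{ij}(t))$, $t\ge 0$, with $P(0)=I$, $P_{ij}(t)\ge0$, $\sum_jP_{ij}(t)\le1$, $P(s+t)=P(s)P(t)$, and $P'(t)=qP(t)=P(t)q$ entrywise. Assume that the rates determine the bilateral birth-death process uniquely, i.e. $\mathcal A$ has at most one transition function, and let $P(t)$ be the transition function of $\mathcal A$. Let $\mathcal A^{+}=(\mathcal A_{ij})_{i,j\ge0}$ and $\mathcal A^{-}=(\mathcal A_{ij})_{i,j\le-1}$ be the operators of the two one-sided processes. Relabel the state $-1-n$ of $\mathcal A^-$ as $n\in\mathbb N_0$, so that $\mathcal A^{+}$ and $\mathcal A^-$ are birth-death operators on $\mathbb N_0$, with birth and death rates $\lambda^+_n=\lambda_n$,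 $\mu^+_n=\mu_n$ and $\lambda^-_n=\mu_{-1-n}$, $\mu^-_n=\lambda_{-1-n}$ respectively, and let $P^{\pm}(t)$ be transition functions of $\mathcal A^{\pm}$. A spectral matrix of the bilateral process is a symmetric matrix $\Psi=(\psi_{\alpha\beta})_{\alpha,\beta=1,2}$ of finite signed measures supported on $[0,\infty)$, with $\Psi(E)$ positive semidefinite for every Borel set $E$, such that the Karlin–McGregor formula $$P_{ij}(t)=\pi_j\sum_{\alpha,\beta=1}^2\int_0^\infty e^{-xt}Q_i^\alpha(x)Q_j^\beta(x)\,d\psi_{\alpha\beta}(x),\qquad i,j\in\mathbb Z,\ t\ge0,$$ holds with absolutely convergent integrals. Here $\pi_0=1$ and, for $n\ge1$, $\pi_n=\frac{\lambda_0\cdots\lambda_{n-1}}{\mu_1\cdots\mu_n}$, $\pi_{-n}=\frac{\mu_0\mu_{-1}\cdots\mu_{-n+1}}{\lambda_{-1}\cdots\lambda_{-n}}$; and $-xQ_n^\alpha=\lambda_nQ_{n+1}^\alpha-(\lambda_n+\mu_n)Q_n^\alpha+\mu_nQ_{n-1}^\alpha$ for $n\in\mathbb Z$, with $Q_0^1=1$,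 $Q_{-1}^1=0$, $Q_0^2=0$, $Q_{-1}^2=1$. A spectral measure of $\mathcal A^{\pm}$ is a finite nonnegative measure $\psi^{\pm}$ supported on $[0,\infty)$ with $$P^{\pm}_{ij}(t)=\pi^{\pm}_j\int_0^\infty e^{-xt}Q^{\pm}_i(x)Q^{\pm}_j(x)\,d\psi^{\pm}(x),\qquad i,j\in\mathbb N_0,\ t\ge 0,$$ with absolutely convergent integrals, where $\pi^{\pm}_n=\frac{\lambda^\pm_0\cdots\lambda^\pm_{n-1}}{\mu^\pm_1\cdots\mu^\pm_n}$ and $Q^\pm_{-1}=0$, $Q^\pm_0=1$, $-xQ_n^\pm=\lambda_n^\pm Q_{n+1}^\pm-(\lambda_n^\pm+\mu_n^\pm)Q_n^\pm+\mu_n^\pm Q_{n-1}^\pm$ for $n\ge 0$. Let $\Psi$ be a spectral matrix of the bilateral process and $\psi^{\pm}$ spectral measures of $\mathcal A^{\pm}$, and put $B(z;\psi)=\int_0^\infty (x-z)^{-1}\,d\psi(x)$. Then for every $z\in\mathbb C\setminus[0,\infty)$ one has $1-\lambda_{-1}\mu_0B(z;\psi^+)B(z;\psi^-)\ne0$ and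 $$B(z;\psi_{11})=\frac{B(z;\psi^+)}{1-\lambda_{-1}\mu_0B(z;\psi^+)B(z;\psi^-)},$$ $$\frac{\mu_0}{\lambda_{-1}}B(z;\psi_{22})=\frac{B(z;\psi^-)}{1-\lambda_{-1}\mu_0B(z;\psi^+)B(z;\psi^-)},$$ $$B(z;\psi_{12})=\frac{\lambda_{-1}B(z;\psi^+)B(z;\psi^-)}{1-\lambda_{-1}\mu_0B(z;\psi^+)B(z;\psi^-)}.$$ -/

import Mathlib

open Set MeasureTheory
open scoped BigOperators

noncomputable section

namespace BirthDeath

/-! ### Infinitesimal operators and transition probability functions -/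

/-- The tridiagonal infinitesimal operator of the birth-death process on `ℕ` with birth rates `l n`
(from `n` to `n + 1`) and death rates `m n` (from `n` to `n - 1`); if `m 0 > 0` the process is
killed from the state `0` at rate `m 0`. -/
def halfLineGenerator (l m : ℕ → ℝ) : Matrix ℕ ℕ ℝ := fun i j =>
  if j = i + 1 then l i else if j = i then -(l i + m i) else if j + 1 = i then m i else 0

/-- The tridiagonal infinitesimal operator of the bilateral birth-death process on `ℤ`. -/
def bilateralGenerator (lam mu : ℤ → ℝ) : Matrix ℤ ℤ ℝ := fun i j =>
  if j = i + 1 then lam i else if j = i then -(lam i + mu i) else if j + 1 = i then mu i else 0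

/-- Birth rates of the process on the nonnegative half-line (state `n` is the integer `n`). -/
def birthPos (lam : ℤ → ℝ) (n : ℕ) : ℝ := lam n

/-- Death rates of the process on the nonnegative half-line. -/
def deathPos (mu : ℤ → ℝ) (n : ℕ) : ℝ := mu n

/-- Birth rates of the process on the negative half-line (state `n` is the integer `-1 - n`, so a
birth is a step to the left). -/
def birthNeg (mu : ℤ → ℝ) (n : ℕ) : ℝ := mu (-1 - n)

/-- Death rates of the process on the negative half-line (a death is a step to the right). -/
def deathNeg (lam : ℤ → ℝ) (n : ℕ) : ℝ := lam (-1 - n)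

/-- The restriction of the bilateral operator to the states `0, 1, 2, …`. -/
theorem submatrix_pos (lam mu : ℤ → ℝ) :
    (bilateralGenerator lam mu).submatrix (fun n : ℕ => (n : ℤ)) (fun n : ℕ => (n : ℤ)) =
      halfLineGenerator (birthPos lam) (deathPos mu) := by
  ext i j
  have h1 : ((j : ℤ) = (i : ℤ) + 1) ↔ j = i + 1 := by omega
  have h2 : ((j : ℤ) = (i : ℤ)) ↔ j = i := by omega
  have h3 : ((j : ℤ) + 1 = (i : ℤ)) ↔ j + 1 = i := by omega
  simp only [Matrix.submatrix_apply, bilateralGenerator, halfLineGenerator, birthPos, deathPos,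
    h1, h2, h3]

/-- The restriction of the bilateral operator to the states `-1, -2, -3, …`. -/
theorem submatrix_neg (lam mu : ℤ → ℝ) :
    (bilateralGenerator lam mu).submatrix (fun n : ℕ => -1 - (n : ℤ)) (fun n : ℕ => -1 - (n : ℤ)) =
      halfLineGenerator (birthNeg mu) (deathNeg lam) := by
  ext i j
  simp only [Matrix.submatrix_apply, bilateralGenerator, halfLineGenerator, birthNeg, deathNeg]
  split_ifs <;> first | omega | rfl | ring

/-- `P t i j` (for `t ≥ 0`) is the transition probability function of a continuous-time Markov
process with infinitesimal operator `q`: nonnegative, substochastic, with `P 0 = 1`, satisfying the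
Chapman-Kolmogorov, backward and forward equations. A row sum less than `1` accounts for killing or
explosion. -/
structure IsTransitionFunction {ι : Type*} [DecidableEq ι] (q : Matrix ι ι ℝ)
    (P : ℝ → Matrix ι ι ℝ) : Prop where
  zero : P 0 = 1
  nonneg : ∀ t, 0 ≤ t → ∀ i j, 0 ≤ P t i j
  summable_row : ∀ t, 0 ≤ t → ∀ i, Summable (P t i)
  row_le_one : ∀ t, 0 ≤ t → ∀ i, ∑' j, P t i j ≤ 1
  chapman_kolmogorov : ∀ s, 0 ≤ s → ∀ t, 0 ≤ t → ∀ i j,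
    P (s + t) i j = ∑' k, P s i k * P t k j
  backward : ∀ t, 0 ≤ t → ∀ i j,
    HasDerivWithinAt (fun u => P u i j) (∑' k, q i k * P t k j) (Ici 0) t
  forward : ∀ t, 0 ≤ t → ∀ i j,
    HasDerivWithinAt (fun u => P u i j) (∑' k, P t i k * q k j) (Ici 0) t

/-- The infinitesimal operator `q` determines the process uniquely. -/
def UniquelyDetermines {ι : Type*} [DecidableEq ι] (q : Matrix ι ι ℝ) : Prop :=
  ∀ P P' : ℝ → Matrix ι ι ℝ, IsTransitionFunction q P → IsTransitionFunction q P' →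
    ∀ t, 0 ≤ t → P t = P' t

/-! ### Potential coefficients and polynomials -/

/-- Potential coefficients on `ℕ`: `π_n = l_0 ⋯ l_{n-1} / (m_1 ⋯ m_n)`. -/
def halfLinePotential (l m : ℕ → ℝ) (n : ℕ) : ℝ :=
  ∏ k ∈ Finset.range n, l k / m (k + 1)

/-- Potential coefficients on `ℤ`: `π_n = lam_0 ⋯ lam_{n-1} / (mu_1 ⋯ mu_n)` for `n ≥ 0` and
`π_{-n} = mu_0 mu_{-1} ⋯ mu_{-n+1} / (lam_{-1} lam_{-2} ⋯ lam_{-n})` for `n ≥ 1`. -/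
def bilateralPotential (lam mu : ℤ → ℝ) : ℤ → ℝ
  | Int.ofNat n => ∏ k ∈ Finset.range n, lam k / mu (k + 1)
  | Int.negSucc n => ∏ k ∈ Finset.range (n + 1), mu (-k) / lam (-(k + 1))

/-- The solution, with the index shifted by one (`recSol l m a b x (n + 1)` is `Q_n(x)`), of
`-x Q_n = l_n Q_{n+1} - (l_n + m_n) Q_n + m_n Q_{n-1}` for `n ≥ 0`, with `Q_{-1} = a`, `Q_0 = b`. -/
def recSol (l m : ℕ → ℝ) (a b x : ℝ) : ℕ → ℝ
  | 0 => a
  | 1 => b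
  | n + 2 => ((l n + m n - x) * recSol l m a b x (n + 1) - m n * recSol l m a b x n) / l n

/-- The polynomials `Q_n(x)`, `n ≥ 0`, of the birth-death process on `ℕ`: `Q_{-1} = 0`, `Q_0 = 1`. -/
def halfLinePoly (l m : ℕ → ℝ) (n : ℕ) (x : ℝ) : ℝ := recSol l m 0 1 x (n + 1)

/-- The solution `Q_n(x)`, `n ∈ ℤ`, of the bilateral recurrence with `Q_{-1} = a` and `Q_0 = b`. -/
def bilateralSol (lam mu : ℤ → ℝ) (a b : ℝ) (x : ℝ) : ℤ → ℝ
  | Int.ofNat n => recSol (birthPos lam) (deathPos mu) a b x (n + 1)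
  | Int.negSucc n => recSol (birthNeg mu) (deathNeg lam) b a x (n + 1)

/-- The two families `Q_n^1` (index `0`) and `Q_n^2` (index `1`):
`Q_0^1 = 1`, `Q_{-1}^1 = 0`, `Q_0^2 = 0`, `Q_{-1}^2 = 1`. -/
def bilateralPoly (lam mu : ℤ → ℝ) (α : Fin 2) (n : ℤ) (x : ℝ) : ℝ :=
  if α = 0 then bilateralSol lam mu 0 1 x n else bilateralSol lam mu 1 0 x n

/-- The three-term recurrence relation on all of `ℤ`. -/
theorem bilateralPoly_rec (lam mu : ℤ → ℝ) (hlam : ∀ n, lam n ≠ 0) (hmu : ∀ n, mu n ≠ 0)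
    (α : Fin 2) (n : ℤ) (x : ℝ) :
    -x * bilateralPoly lam mu α n x = lam n * bilateralPoly lam mu α (n + 1) x
      - (lam n + mu n) * bilateralPoly lam mu α n x + mu n * bilateralPoly lam mu α (n - 1) x := by
  have key : ∀ a b : ℝ, -x * bilateralSol lam mu a b x n = lam n * bilateralSol lam mu a b x (n + 1)
      - (lam n + mu n) * bilateralSol lam mu a b x n
      + mu n * bilateralSol lam mu a b x (n - 1) := by
    intro a b
    rcases n with n | n
    · have e1 : (Int.ofNat n + 1 : ℤ) = Int.ofNat (n + 1) := rfl
      rw [e1]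
      rcases n with _ | n
      · have e2 : (Int.ofNat 0 - 1 : ℤ) = Int.negSucc 0 := rfl
        rw [e2]
        have h := hlam 0
        simp [bilateralSol, recSol, birthPos, deathPos]
        field_simp
        ring
      · have e2 : (Int.ofNat (n + 1) - 1 : ℤ) = Int.ofNat n := by simp
        rw [e2]
        have h := hlam (n + 1)
        simp only [bilateralSol, recSol, birthPos, deathPos, Int.ofNat_eq_natCast]
        push_cast
        field_simp
        ring
    · have e1 : (Int.negSucc n - 1 : ℤ) = Int.negSucc (n + 1) := by
        rw [Int.negSucc_eq, Int.negSucc_eq]; push_cast; ring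
      rw [e1]
      rcases n with _ | n
      · have e2 : (Int.negSucc 0 + 1 : ℤ) = Int.ofNat 0 := rfl
        have e3 : (Int.negSucc 0 : ℤ) = -1 := rfl
        rw [e2]
        have h := hmu (-1)
        simp [bilateralSol, recSol, birthNeg, deathNeg]
        field_simp
        ring
      · have e2 : (Int.negSucc (n + 1) + 1 : ℤ) = Int.negSucc n := by
          rw [Int.negSucc_eq, Int.negSucc_eq]; push_cast; ring
        rw [e2]
        have e3 : (Int.negSucc (n + 1) : ℤ) = -1 - ((n + 1 : ℕ) : ℤ) := by
          rw [Int.negSucc_eq]; push_cast; ring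
        have h := hmu (-1 - ((n + 1 : ℕ) : ℤ))
        simp only [bilateralSol, recSol, birthNeg, deathNeg]
        rw [e3]
        field_simp
        ring
  unfold bilateralPoly
  split_ifs
  · exact key 0 1
  · exact key 1 0

/-! ### Spectral measures and Stieltjes transforms -/

/-- `ψ` is the spectral measure of the birth-death process on `ℕ` with rates `l`, `m` and transition
function `P`: a (finite, nonnegative) measure supported on `[0, ∞)` that represents `P` by the
Karlin-McGregor formula. -/
structure IsSpectralMeasure (l m : ℕ → ℝ) (P : ℝ → Matrix ℕ ℕ ℝ) (ψ : Measure ℝ) : Prop where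
  finite : IsFiniteMeasure ψ
  support : ψ (Iio 0) = 0
  integrable : ∀ t, 0 ≤ t → ∀ i j : ℕ, IntegrableOn
    (fun x => Real.exp (-x * t) * (halfLinePoly l m i x * halfLinePoly l m j x)) (Ici 0) ψ
  karlin_mcgregor : ∀ t, 0 ≤ t → ∀ i j : ℕ,
    P t i j = halfLinePotential l m j *
      ∫ x in Ici 0, Real.exp (-x * t) * (halfLinePoly l m i x * halfLinePoly l m j x) ∂ψ

/-- `Ψ` is the spectral matrix of the bilateral birth-death process with rates `lam`, `mu` and
transition function `P`: a symmetric positive semidefinite matrix of (finite, signed) measures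
supported on `[0, ∞)` that represents `P` by the Karlin-McGregor formula. -/
structure IsSpectralMatrix (lam mu : ℤ → ℝ) (P : ℝ → Matrix ℤ ℤ ℝ)
    (Ψ : Matrix (Fin 2) (Fin 2) (SignedMeasure ℝ)) : Prop where
  posSemidef : ∀ E : Set ℝ, MeasurableSet E →
    (Matrix.of fun α β : Fin 2 => (Ψ α β : Set ℝ → ℝ) E).PosSemidef
  support : ∀ E : Set ℝ, MeasurableSet E → E ⊆ Iio 0 → ∀ α β, Ψ α β E = 0
  integrable : ∀ t, 0 ≤ t → ∀ i j : ℤ, ∀ α β : Fin 2, (Ψ α β).IntegrableOn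
    (fun x => Real.exp (-x * t) * (bilateralPoly lam mu α i x * bilateralPoly lam mu β j x)) (Ici 0)
  karlin_mcgregor : ∀ t, 0 ≤ t → ∀ i j : ℤ,
    P t i j = bilateralPotential lam mu j * ∑ α : Fin 2, ∑ β : Fin 2,
      ∫ᵛ x in Ici 0, Real.exp (-x * t) *
        (bilateralPoly lam mu α i x * bilateralPoly lam mu β j x) ∂<•(Ψ α β)

/-- The Stieltjes transform `B(z; ψ) = ∫_{[0, ∞)} (x - z)⁻¹ dψ(x)` of a measure. -/
def stieltjes (z : ℂ) (ψ : Measure ℝ) : ℂ := ∫ x in Ici 0, ((x : ℂ) - z)⁻¹ ∂ψ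

/-- The Stieltjes transform `B(z; ψ) = ∫_{[0, ∞)} (x - z)⁻¹ dψ(x)` of a signed measure. -/
def signedStieltjes (z : ℂ) (ψ : SignedMeasure ℝ) : ℂ :=
  ∫ᵛ x in Ici 0, ((x : ℂ) - z)⁻¹ ∂<•ψ

end BirthDeath

end

namespace BirthDeath

open scoped ENNReal Topology

/-! ### Convolution of extended nonnegative functions on the line -/

section Convolution

/-! Run the two one-sided processes side by side on ℤ. The resulting generator is the bilateral one
with the two transitions 0 → -1 (rate μ_0) and -1 → 0 (rate λ_{-1}) deleted and the diagonal
unchanged, so an attempt to cross between the half-lines kills the glued process. Reinstating the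
crossings and summing over their number gives a Dyson series p = d + dcd + dcdcd + ⋯, where d is the
glued kernel. This series is a transition function of the bilateral operator
(`IsTransitionFunction.dyson`), so by uniqueness it is P.

Splitting the series at its first crossing yields `renewal_equations`: p_00 = u + μ_0 u ⋆ p_{-1,0},
p_{-1,0} = λ_{-1} v ⋆ p_00 and their mirror images, with u and v the return functions of the end
states of the two half-lines. At the states 0 and -1 the polynomials Q^α are the constants 0 and 1,
so the Karlin–McGregor formula presents these functions as Laplace integrals against ψ_{αβ} and ψ^±.
Their Laplace transforms at s > 0 are therefore Stieltjes transforms at z = -s, and convolution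
becomes multiplication. Eliminating unknowns gives (1 - λ_{-1}μ_0 B⁺B⁻) B(ψ_11) = B⁺ and the two
companion relations. Both sides are holomorphic off [0, ∞), so the identity theorem extends them. A
zero of the denominator would force B⁺ = 0, and then the denominator would be 1.

The main work is to show that the Dyson series is a transition function. All kernels take values in
[0, ∞], so sums and integrals commute freely; differential equations are kept in integrated form
with loss terms moved to the other side, since subtraction is not available. Chapman–Kolmogorov
follows by counting crossings before and after an intermediate time. The forward equation is the
backward equation of the transposed data. Substochasticity rests on
`IsTransitionFunction.tsum_add_integral_le`: survival probability plus mass lost through the two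
channels is at most one. -/

theorem lconvolution_add_right {f g h : ℝ → ℝ≥0∞} (hf : Measurable f) (hg : Measurable g) :
    f ⋆ₗ (g + h) = f ⋆ₗ g + f ⋆ₗ h := by
  ext t
  simp only [lconvolution_def, Pi.add_apply, mul_add]
  rw [lintegral_add_left (by fun_prop)]

theorem lconvolution_add_left {f g h : ℝ → ℝ≥0∞} (hf : Measurable f) (hh : Measurable h) :
    (f + g) ⋆ₗ h = f ⋆ₗ h + g ⋆ₗ h := by
  rw [lconvolution_comm, lconvolution_add_right hh hf, lconvolution_comm (f := h),
    lconvolution_comm (f := h)]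

theorem lconvolution_smul_right {f g : ℝ → ℝ≥0∞} (hf : Measurable f) (hg : Measurable g)
    (c : ℝ≥0∞) : f ⋆ₗ (c • g) = c • (f ⋆ₗ g) := by
  ext t
  simp only [lconvolution_def, Pi.smul_apply, smul_eq_mul]
  rw [← lintegral_const_mul _ (by fun_prop)]
  simp only [mul_left_comm]

theorem lconvolution_smul_left {f g : ℝ → ℝ≥0∞} (hf : Measurable f) (hg : Measurable g)
    (c : ℝ≥0∞) : (c • f) ⋆ₗ g = c • (f ⋆ₗ g) := by
  rw [lconvolution_comm, lconvolution_smul_right hg hf, lconvolution_comm (f := g)]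

theorem lconvolution_sum_right {κ : Type*} (s : Finset κ) {f : ℝ → ℝ≥0∞} {g : κ → ℝ → ℝ≥0∞}
    (hf : Measurable f) (hg : ∀ k, Measurable (g k)) :
    f ⋆ₗ (∑ k ∈ s, g k) = ∑ k ∈ s, f ⋆ₗ g k := by
  ext t
  simp only [lconvolution_def, Finset.sum_apply, Finset.mul_sum]
  rw [lintegral_finsetSum _ (fun k _ => by have := hg k; fun_prop)]

theorem lconvolution_sum_left {κ : Type*} (s : Finset κ) {f : κ → ℝ → ℝ≥0∞} {g : ℝ → ℝ≥0∞}
    (hf : ∀ k, Measurable (f k)) (hg : Measurable g) :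
    (∑ k ∈ s, f k) ⋆ₗ g = ∑ k ∈ s, f k ⋆ₗ g := by
  rw [lconvolution_comm, lconvolution_sum_right s hg hf]
  simp only [lconvolution_comm (f := g)]

theorem lconvolution_tsum_right {κ : Type*} [Countable κ] {f : ℝ → ℝ≥0∞} {g : κ → ℝ → ℝ≥0∞}
    (hf : Measurable f) (hg : ∀ k, Measurable (g k)) (t : ℝ) :
    (f ⋆ₗ fun u => ∑' k, g k u) t = ∑' k, (f ⋆ₗ g k) t := by
  simp only [lconvolution_def, ← ENNReal.tsum_mul_left]
  rw [lintegral_tsum (fun k => by have := hg k; fun_prop)]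

theorem lconvolution_mono_right {f g h : ℝ → ℝ≥0∞} (hgh : ∀ t, g t ≤ h t) (t : ℝ) :
    (f ⋆ₗ g) t ≤ (f ⋆ₗ h) t := by
  simp only [lconvolution_def]
  gcongr
  exact hgh _

/-- For t < 0 the integrand vanishes identically; for t = 0 it can be nonzero only at the point y =
0, a null set. The case t = 0 is what makes all but the zeroth Dyson term vanish at time 0. -/
theorem lconvolution_eq_zero_of_nonpos {f g : ℝ → ℝ≥0∞} (hf : ∀ t < 0, f t = 0)
    (hg : ∀ t < 0, g t = 0) {t : ℝ} (ht : t ≤ 0) : (f ⋆ₗ g) t = 0 := by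
  rw [lconvolution_def]
  have : (fun y => f y * g (-y + t)) =ᵐ[volume] fun _ => 0 := by
    have h0 : ∀ᵐ y : ℝ, y ≠ 0 := by simp [ae_iff]
    filter_upwards [h0] with y hy
    rcases lt_or_gt_of_ne hy with h | h
    · simp [hf y h]
    · simp [hg (-y + t) (by linarith)]
  rw [lintegral_congr_ae this, lintegral_zero]

/-- Splitting a causal convolution at time `s`. -/
theorem lconvolution_add_time {f g : ℝ → ℝ≥0∞} (s t : ℝ) :
    (f ⋆ₗ g) (s + t) = (∫⁻ y in Iic s, f y * g (-y + (s + t))) +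
      ∫⁻ v in Ioi 0, f (s + v) * g (-v + t) := by
  rw [lconvolution_def, ← lintegral_add_compl _ (measurableSet_Iic (a := s)), compl_Iic]
  congr 1
  -- The translation y = s + v carries the tail (s, ∞) to (0, ∞).
  rw [← lintegral_indicator measurableSet_Ioi, ← lintegral_indicator measurableSet_Ioi,
    ← lintegral_add_left_eq_self _ s]
  congr 1
  ext v
  by_cases h : 0 < v
  · rw [indicator_of_mem (by simpa using h), indicator_of_mem (by simpa using h)]
    congr 2; ring
  · rw [indicator_of_notMem (by simpa using h), indicator_of_notMem (by simpa using h)]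

theorem setLIntegral_Ioi_eq_lconvolution {f g : ℝ → ℝ≥0∞} (hf : ∀ t < 0, f t = 0) (t : ℝ) :
    ∫⁻ v in Ioi 0, f v * g (-v + t) = (f ⋆ₗ g) t := by
  rw [lconvolution_def, setLIntegral_congr Ioi_ae_eq_Ici, ← lintegral_indicator measurableSet_Ici]
  congr 1
  ext v
  by_cases h : 0 ≤ v
  · rw [indicator_of_mem (by simpa using h)]
  · rw [indicator_of_notMem (by simpa using h), hf v (not_le.mp h), zero_mul]

theorem setLIntegral_Iic_eq_lconvolution {f g : ℝ → ℝ≥0∞} (hg : ∀ t < 0, g t = 0) (s : ℝ) :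
    ∫⁻ y in Iic s, f y * g (-y + s) = (f ⋆ₗ g) s := by
  rw [lconvolution_def, ← lintegral_indicator measurableSet_Iic]
  congr 1
  ext v
  by_cases h : v ≤ s
  · rw [indicator_of_mem (by simpa using h)]
  · rw [indicator_of_notMem (by simpa using h), hg _ (by linarith), mul_zero]

/-- The indicator function of `[0, ∞)`. -/
noncomputable def heaviside : ℝ → ℝ≥0∞ := (Ici 0).indicator 1

theorem measurable_heaviside : Measurable heaviside :=
  measurable_one.indicator measurableSet_Ici

theorem heaviside_of_neg {t : ℝ} (ht : t < 0) : heaviside t = 0 :=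
  indicator_of_notMem (by simpa using ht) _

theorem heaviside_of_nonneg {t : ℝ} (ht : 0 ≤ t) : heaviside t = 1 := by
  simp [heaviside, indicator_of_mem (mem_Ici.2 ht)]

end Convolution

/-! ### The Dyson series of a kernel perturbed by finitely many transitions -/

section Dyson

variable {ι ε : Type*} [Fintype ε]

/-- The contribution of the paths which use exactly `n` of the added transitions. -/
noncomputable def dysonTerm (d : ι → ι → ℝ → ℝ≥0∞) (a b : ε → ι) (c : ε → ℝ≥0∞) :
    ℕ → ι → ι → ℝ → ℝ≥0∞
  | 0 => d
  | n + 1 => fun i j => ∑ e, c e • (d i (a e) ⋆ₗ dysonTerm d a b c n (b e) j)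

/-- The Dyson series for the perturbation of the kernel `d` by transitions from `a e` to `b e` at
rate `c e`. -/
noncomputable def dyson (d : ι → ι → ℝ → ℝ≥0∞) (a b : ε → ι) (c : ε → ℝ≥0∞) (i j : ι) (t : ℝ) :
    ℝ≥0∞ := ∑' n, dysonTerm d a b c n i j t

variable {d : ι → ι → ℝ → ℝ≥0∞} {a b : ε → ι} {c : ε → ℝ≥0∞}

theorem measurable_dysonTerm (hd : ∀ i j, Measurable (d i j)) (n : ℕ) :
    ∀ i j, Measurable (dysonTerm d a b c n i j) := by
  induction n with
  | zero => exact hd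
  | succ n ih =>
    intro i j
    refine Finset.sum_induction _ Measurable (fun _ _ => Measurable.add) measurable_zero fun e _ => ?_
    exact (measurable_lconvolution _ (hd _ _) (ih _ _)).const_smul (c e)

theorem measurable_dyson (hd : ∀ i j, Measurable (d i j)) (i j : ι) :
    Measurable (dyson d a b c i j) :=
  Measurable.tsum fun n => measurable_dysonTerm hd n i j

theorem dysonTerm_of_neg (hd0 : ∀ i j, ∀ t < 0, d i j t = 0) (n : ℕ) :
    ∀ i j, ∀ t < 0, dysonTerm d a b c n i j t = 0 := by
  induction n with
  | zero => exact hd0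
  | succ n ih =>
    intro i j t ht
    simp only [dysonTerm, Finset.sum_apply, Pi.smul_apply]
    exact Finset.sum_eq_zero fun e _ => by
      rw [lconvolution_eq_zero_of_nonpos (hd0 _ _) (ih _ _) ht.le, smul_zero]

theorem dyson_of_neg (hd0 : ∀ i j, ∀ t < 0, d i j t = 0) (i j : ι) {t : ℝ} (ht : t < 0) :
    dyson d a b c i j t = 0 := by
  simp [dyson, dysonTerm_of_neg hd0 _ i j t ht]

theorem dyson_zero (hd0 : ∀ i j, ∀ t < 0, d i j t = 0) (i j : ι) :
    dyson d a b c i j 0 = d i j 0 := by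
  rw [dyson, tsum_eq_single 0]
  · rfl
  · rintro (_ | n) h
    · exact absurd rfl h
    · simp only [dysonTerm, Finset.sum_apply, Pi.smul_apply]
      exact Finset.sum_eq_zero fun e _ => by
        rw [lconvolution_eq_zero_of_nonpos (hd0 _ _) (dysonTerm_of_neg hd0 n _ _) le_rfl, smul_zero]

/-- Either no added transition is used, or the path is split at the first one. For the glued kernel
this identity becomes the renewal equations. -/
theorem dyson_eq (hd : ∀ i j, Measurable (d i j)) (i j : ι) :
    dyson d a b c i j = d i j + ∑ e, c e • (d i (a e) ⋆ₗ dyson d a b c (b e) j) := by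
  ext t
  simp only [dyson, Pi.add_apply, Finset.sum_apply, Pi.smul_apply, smul_eq_mul]
  rw [tsum_eq_zero_add' ENNReal.summable]
  simp only [dysonTerm, Finset.sum_apply, Pi.smul_apply, smul_eq_mul]
  rw [Summable.tsum_finsetSum (fun _ _ => ENNReal.summable)]
  congr 1
  refine Finset.sum_congr rfl fun e _ => ?_
  rw [ENNReal.tsum_mul_left, ← lconvolution_tsum_right (hd _ _)
    (fun n => measurable_dysonTerm hd n _ _)]
  rfl

/-- The definition splits a path at its first added transition; splitting at the last one gives the
same iterated convolution, by associativity and an exchange of two finite sums. This symmetry is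
what makes the series compatible with transposition. -/
theorem dysonTerm_succ_right (hd : ∀ i j, Measurable (d i j)) (n : ℕ) :
    ∀ i j, dysonTerm d a b c (n + 1) i j =
      ∑ e, c e • (dysonTerm d a b c n i (a e) ⋆ₗ d (b e) j) := by
  induction n with
  | zero => intro i j; rfl
  | succ n ih =>
    intro i j
    have hm := fun i j => measurable_dysonTerm (a := a) (b := b) (c := c) hd n i j
    have hm1 : ∀ i j k l, Measurable (dysonTerm d a b c n i j ⋆ₗ d k l) :=
      fun i j k l => measurable_lconvolution _ (hm _ _) (hd _ _)
    have hm2 : ∀ i j k l, Measurable (d i j ⋆ₗ dysonTerm d a b c n k l) :=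
      fun i j k l => measurable_lconvolution _ (hd _ _) (hm _ _)
    calc dysonTerm d a b c (n + 1 + 1) i j
        = ∑ e, c e • (d i (a e) ⋆ₗ
            ∑ e', c e' • (dysonTerm d a b c n (b e) (a e') ⋆ₗ d (b e') j)) := by
          simp only [← ih]; rfl
      _ = ∑ e, ∑ e', c e • c e' • (d i (a e) ⋆ₗ
            (dysonTerm d a b c n (b e) (a e') ⋆ₗ d (b e') j)) := by
          refine Finset.sum_congr rfl fun e _ => ?_
          rw [lconvolution_sum_right _ (hd _ _) (fun k => (hm1 _ _ _ _).const_smul _),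
            Finset.smul_sum]
          simp only [lconvolution_smul_right (hd _ _) (hm1 _ _ _ _)]
      _ = ∑ e', ∑ e, c e' • c e • ((d i (a e) ⋆ₗ
            dysonTerm d a b c n (b e) (a e')) ⋆ₗ d (b e') j) := by
          rw [Finset.sum_comm]
          simp only [lconvolution_assoc (hd _ _) (hm _ _) (hd _ _), smul_comm (c _) (c _)]
      _ = ∑ e', c e' • (dysonTerm d a b c (n + 1) i (a e') ⋆ₗ d (b e') j) := by
          refine Finset.sum_congr rfl fun e' _ => ?_
          simp only [dysonTerm]
          rw [lconvolution_sum_left _ (fun k => (hm2 _ _ _ _).const_smul _) (hd _ _),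
            Finset.smul_sum]
          simp only [lconvolution_smul_left (hm2 _ _ _ _) (hd _ _)]

/-- Reversing paths exchanges the sources `a` and the targets `b`. Backward statements about the
series thereby become forward ones. -/
theorem dysonTerm_transpose (hd : ∀ i j, Measurable (d i j)) (n : ℕ) :
    ∀ i j, dysonTerm (fun i j => d j i) b a c n i j = dysonTerm d a b c n j i := by
  induction n with
  | zero => intro i j; rfl
  | succ n ih =>
    intro i j
    rw [dysonTerm_succ_right hd]
    simp only [dysonTerm, ih]
    exact Finset.sum_congr rfl fun e _ => by rw [lconvolution_comm]

theorem dyson_transpose (hd : ∀ i j, Measurable (d i j)) (i j : ι) :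
    dyson (fun i j => d j i) b a c i j = dyson d a b c j i := by
  ext t
  simp only [dyson, dysonTerm_transpose hd]

/-! ### Semigroup property and row sums of the Dyson series. -/

section ChapmanKolmogorov

variable [Countable ι]

/-- Of the `n` added transitions, `p.1` occur before time `s` and `p.2` after. The induction looks
at the first of them. If it occurs before `s` (`first`), the induction hypothesis splits the rest of
the path. If it occurs after `s` (`second`), the semigroup property of `d` carries the path up to
time `s`, which is the term `p.1 = 0` of the antidiagonal. -/
theorem dysonTerm_add_time (hd : ∀ i j, Measurable (d i j)) (hd0 : ∀ i j, ∀ t < 0, d i j t = 0)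
    (hck : ∀ s, 0 ≤ s → ∀ t, 0 ≤ t → ∀ i j, d i j (s + t) = ∑' k, d i k s * d k j t) (n : ℕ) :
    ∀ s, 0 ≤ s → ∀ t, 0 ≤ t → ∀ i j, dysonTerm d a b c n i j (s + t) =
      ∑ p ∈ Finset.HasAntidiagonal.antidiagonal n, ∑' k,
        dysonTerm d a b c p.1 i k s * dysonTerm d a b c p.2 k j t := by
  induction n with
  | zero => intro s hs t ht i j; simpa [dysonTerm] using hck s hs t ht i j
  | succ n ih =>
    intro s hs t ht i j
    set U := dysonTerm d a b c with hU
    have hm : ∀ n i j, Measurable (U n i j) := measurable_dysonTerm hd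
    have h0 : ∀ n i j, ∀ t < 0, U n i j t = 0 := dysonTerm_of_neg hd0
    have first : ∀ e, ∫⁻ y in Iic s, d i (a e) y * U n (b e) j (-y + (s + t)) =
        ∑ p ∈ Finset.HasAntidiagonal.antidiagonal n, ∑' k, (d i (a e) ⋆ₗ U p.1 (b e) k) s * U p.2 k j t := by
      intro e
      calc _ = ∫⁻ y in Iic s, ∑ p ∈ Finset.HasAntidiagonal.antidiagonal n, ∑' k,
              d i (a e) y * U p.1 (b e) k (-y + s) * U p.2 k j t := by
            refine setLIntegral_congr_fun measurableSet_Iic fun y hy => ?_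
            have := ih (-y + s) (by simpa using hy) t ht (b e) j
            simp only [← add_assoc, this, Finset.mul_sum, ← ENNReal.tsum_mul_left, mul_assoc]
        _ = _ := by
            rw [lintegral_finsetSum _ (fun p _ => by
              refine Measurable.tsum fun k => ?_
              have := hm p.1 (b e) k; have := hd i (a e); fun_prop)]
            refine Finset.sum_congr rfl fun p _ => ?_
            have hmm : ∀ k, Measurable fun y => d i (a e) y * U p.1 (b e) k (-y + s) := by
              intro k; have := hm p.1 (b e) k; have := hd i (a e); fun_prop
            rw [lintegral_tsum (fun k => ((hmm k).mul_const _).aemeasurable)]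
            refine tsum_congr fun k => ?_
            rw [lintegral_mul_const _ (hmm k), setLIntegral_Iic_eq_lconvolution (h0 _ _ _)]
    have second : ∀ e, ∫⁻ v in Ioi 0, d i (a e) (s + v) * U n (b e) j (-v + t) =
        ∑' k, d i k s * (d k (a e) ⋆ₗ U n (b e) j) t := by
      intro e
      calc _ = ∫⁻ v in Ioi 0, ∑' k, d i k s * (d k (a e) v * U n (b e) j (-v + t)) := by
            refine setLIntegral_congr_fun measurableSet_Ioi fun v hv => ?_
            simp only [hck s hs v (le_of_lt hv), ← ENNReal.tsum_mul_right, mul_assoc]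
        _ = _ := by
            have hmm : ∀ k, Measurable fun v => d k (a e) v * U n (b e) j (-v + t) := by
              intro k; have := hm n (b e) j; have := hd k (a e); fun_prop
            rw [lintegral_tsum (fun k => ((hmm k).const_mul _).aemeasurable)]
            refine tsum_congr fun k => ?_
            rw [lintegral_const_mul _ (hmm k), setLIntegral_Ioi_eq_lconvolution (hd0 _ _)]
    have hsucc : ∀ n i j t, U (n + 1) i j t = ∑ e, c e * (d i (a e) ⋆ₗ U n (b e) j) t := by
      intro n i j t; simp [hU, dysonTerm]
    rw [Finset.Nat.sum_antidiagonal_succ, hsucc]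
    simp only [lconvolution_add_time, first, second, hsucc, mul_add, Finset.sum_add_distrib]
    rw [add_comm]
    congr 1
    · simp only [Finset.mul_sum]
      rw [Summable.tsum_finsetSum (fun _ _ => ENNReal.summable)]
      refine Finset.sum_congr rfl fun e _ => ?_
      rw [← ENNReal.tsum_mul_left]
      exact tsum_congr fun k => by rw [mul_left_comm]; rfl
    · simp only [Finset.mul_sum, Finset.sum_mul]
      rw [Finset.sum_comm]
      refine Finset.sum_congr rfl fun p _ => ?_
      rw [Summable.tsum_finsetSum (fun _ _ => ENNReal.summable)]
      refine Finset.sum_congr rfl fun e _ => ?_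
      rw [← ENNReal.tsum_mul_left]
      exact tsum_congr fun k => by rw [mul_assoc]

theorem tsum_mul_tsum_eq_tsum_sum_antidiagonal (f g : ℕ → ℝ≥0∞) :
    (∑' n, f n) * ∑' n, g n =
      ∑' n, ∑ p ∈ Finset.HasAntidiagonal.antidiagonal n, f p.1 * g p.2 := by
  rw [← ENNReal.tsum_mul_right]
  simp only [← ENNReal.tsum_mul_left]
  rw [← ENNReal.tsum_prod, ← Finset.HasAntidiagonal.sigmaAntidiagonalEquivProd.tsum_eq,
    ENNReal.tsum_sigma']
  exact tsum_congr fun n => Finset.tsum_subtype (Finset.HasAntidiagonal.antidiagonal n)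
    (fun p => f p.1 * g p.2)

/-- The Chapman-Kolmogorov equation for the Dyson series. -/
theorem dyson_add_time (hd : ∀ i j, Measurable (d i j)) (hd0 : ∀ i j, ∀ t < 0, d i j t = 0)
    (hck : ∀ s, 0 ≤ s → ∀ t, 0 ≤ t → ∀ i j, d i j (s + t) = ∑' k, d i k s * d k j t)
    {s t : ℝ} (hs : 0 ≤ s) (ht : 0 ≤ t) (i j : ι) :
    dyson d a b c i j (s + t) = ∑' k, dyson d a b c i k s * dyson d a b c k j t := by
  simp only [dyson, dysonTerm_add_time hd hd0 hck _ s hs t ht,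
    tsum_mul_tsum_eq_tsum_sum_antidiagonal]
  rw [ENNReal.tsum_comm]
  exact tsum_congr fun n => (Summable.tsum_finsetSum (fun _ _ => ENNReal.summable)).symm

/-- Induction on a truncation to fewer than `N` added transitions. After the first added transition,
the induction hypothesis bounds the remaining mass by `heaviside`. Hence the total is at most the
mass that uses no added transition plus the mass that leaves through a channel, and `hrow` bounds
that by one. -/
theorem tsum_dyson_le (hd : ∀ i j, Measurable (d i j)) (hd0 : ∀ i j, ∀ t < 0, d i j t = 0)
    (hrow : ∀ i t, 0 ≤ t → ∑' j, d i j t + ∑ e, c e * (d i (a e) ⋆ₗ heaviside) t ≤ 1)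
    (i : ι) (t : ℝ) : ∑' j, dyson d a b c i j t ≤ heaviside t := by
  have key : ∀ N i t, ∑' j, ∑ n ∈ Finset.range N, dysonTerm d a b c n i j t ≤ heaviside t := by
    intro N
    induction N with
    | zero => intro i t; simp
    | succ N ih =>
      intro i t
      rcases lt_or_ge t 0 with ht | ht
      · simp [dysonTerm_of_neg hd0 _ _ _ t ht]
      rw [heaviside_of_nonneg ht]
      refine le_trans ?_ (hrow i t ht)
      have hs : ∀ j, ∑ n ∈ Finset.range (N + 1), dysonTerm d a b c n i j t = d i j t +
          ∑ e, c e * (d i (a e) ⋆ₗ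
            ∑ n ∈ Finset.range N, dysonTerm d a b c n (b e) j) t := by
        intro j
        rw [Finset.sum_range_succ', add_comm]
        congr 1
        simp only [dysonTerm, Finset.sum_apply, Pi.smul_apply, smul_eq_mul]
        rw [Finset.sum_comm]
        refine Finset.sum_congr rfl fun e _ => ?_
        rw [lconvolution_sum_right _ (hd _ _)
          (fun n => measurable_dysonTerm (a := a) (b := b) (c := c) hd n _ _),
          Finset.sum_apply, Finset.mul_sum]
      simp only [hs]
      rw [ENNReal.summable.tsum_add ENNReal.summable,
        Summable.tsum_finsetSum (fun _ _ => ENNReal.summable)]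
      gcongr with e
      rw [ENNReal.tsum_mul_left]
      gcongr
      have hm : ∀ j, Measurable (∑ n ∈ Finset.range N, dysonTerm d a b c n (b e) j) :=
        fun j => Finset.sum_induction _ Measurable (fun _ _ => Measurable.add) measurable_zero
          fun n _ => measurable_dysonTerm hd n _ _
      rw [← lconvolution_tsum_right (hd _ _) hm]
      refine lconvolution_mono_right (fun u => ?_) t
      simpa using ih (b e) u
  simp only [dyson]
  rw [ENNReal.tsum_comm]
  refine ENNReal.tsum_le_of_sum_range_le fun N => ?_
  rw [← Summable.tsum_finsetSum (fun _ _ => ENNReal.summable)]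
  exact key N i t

end ChapmanKolmogorov

/-- The integrated backward equation for the Dyson series. -/
theorem dyson_backward [DecidableEq ι] (hd : ∀ i j, Measurable (d i j))
    {v : ι → ℝ≥0∞} {S : ι → Finset ι} {w : ι → ι → ℝ≥0∞}
    (hback : ∀ i j, d i j + v i • (heaviside ⋆ₗ d i j) =
      (if i = j then heaviside else 0) + ∑ k ∈ S i, w i k • (heaviside ⋆ₗ d k j)) (i j : ι) :
    dyson d a b c i j + v i • (heaviside ⋆ₗ dyson d a b c i j) =
      (if i = j then heaviside else 0) + (∑ k ∈ S i, w i k • (heaviside ⋆ₗ dyson d a b c k j) +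
        ∑ e, if i = a e then c e • (heaviside ⋆ₗ dyson d a b c (b e) j) else 0) := by
  set p := dyson d a b c with hp
  have hH := measurable_heaviside
  have hpm : ∀ i j, Measurable (p i j) := measurable_dyson hd
  have hmd : ∀ i j, Measurable (heaviside ⋆ₗ d i j) := fun i j => measurable_lconvolution _ hH (hd _ _)
  have hmdp : ∀ i j k l, Measurable (d i j ⋆ₗ p k l) :=
    fun i j k l => measurable_lconvolution _ (hd _ _) (hpm _ _)
  have hHp : ∀ i j, heaviside ⋆ₗ p i j =
      heaviside ⋆ₗ d i j + ∑ e, c e • ((heaviside ⋆ₗ d i (a e)) ⋆ₗ p (b e) j) := by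
    intro i j
    conv_lhs => rw [hp, dyson_eq hd]
    rw [lconvolution_add_right hH (hd _ _), lconvolution_sum_right _ hH
      (fun e => (hmdp _ _ _ _).const_smul _)]
    simp only [lconvolution_smul_right hH (hmdp _ _ _ _),
      lconvolution_assoc hH (hd _ _) (hpm _ _)]
  -- The backward equation of `d` in column `a e`, convolved on the right with `p (b e) j`. Its
  -- initial term survives only for `i = a e`, and there it produces the contribution of the added
  -- transition to the generator.
  have step : ∀ e, d i (a e) ⋆ₗ p (b e) j + v i • ((heaviside ⋆ₗ d i (a e)) ⋆ₗ p (b e) j) =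
      (if i = a e then heaviside ⋆ₗ p (b e) j else 0) +
        ∑ k ∈ S i, w i k • ((heaviside ⋆ₗ d k (a e)) ⋆ₗ p (b e) j) := by
    intro e
    rw [← lconvolution_smul_left (hmd _ _) (hpm _ _), ← lconvolution_add_left (hd _ _) (hpm _ _),
      hback, lconvolution_add_left (by split_ifs <;> fun_prop) (hpm _ _),
      lconvolution_sum_left _ (fun k => (hmd _ _).const_smul _) (hpm _ _)]
    simp only [lconvolution_smul_left (hmd _ _) (hpm _ _)]
    split_ifs <;> simp
  have hsum : ∑ e, c e • (d i (a e) ⋆ₗ p (b e) j + v i • ((heaviside ⋆ₗ d i (a e)) ⋆ₗ p (b e) j)) =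
      ∑ e, (if i = a e then c e • (heaviside ⋆ₗ p (b e) j) else 0) +
        ∑ k ∈ S i, w i k • ∑ e, c e • ((heaviside ⋆ₗ d k (a e)) ⋆ₗ p (b e) j) := by
    simp only [step, smul_add, Finset.sum_add_distrib, Finset.smul_sum]
    rw [Finset.sum_comm]
    congr 1
    · refine Finset.sum_congr rfl fun e _ => ?_
      split_ifs <;> simp
    · refine Finset.sum_congr rfl fun k _ => Finset.sum_congr rfl fun e _ => smul_comm _ _ _
  calc p i j + v i • (heaviside ⋆ₗ p i j)
      = (d i j + v i • (heaviside ⋆ₗ d i j)) + ∑ e, c e • (d i (a e) ⋆ₗ p (b e) j +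
          v i • ((heaviside ⋆ₗ d i (a e)) ⋆ₗ p (b e) j)) := by
        rw [hHp]
        conv_lhs => rw [hp, dyson_eq hd, ← hp]
        simp only [smul_add, Finset.sum_add_distrib, Finset.smul_sum, smul_comm (v i)]
        abel
    _ = _ := by
        rw [hback, hsum]
        simp only [hHp, smul_add, Finset.sum_add_distrib]
        abel

end Dyson

/-! ### Integrated differential equations -/

section Causal

/-- The extension by zero to negative times of a real function on `[0, ∞)`. -/
noncomputable def causalExt (f : ℝ → ℝ) : ℝ → ℝ≥0∞ := (Ici 0).indicator fun t => ENNReal.ofReal (f t)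

theorem causalExt_of_neg (f : ℝ → ℝ) {t : ℝ} (ht : t < 0) : causalExt f t = 0 :=
  indicator_of_notMem (by simpa using ht) _

theorem causalExt_of_nonneg (f : ℝ → ℝ) {t : ℝ} (ht : 0 ≤ t) :
    causalExt f t = ENNReal.ofReal (f t) :=
  indicator_of_mem (mem_Ici.2 ht) _

theorem measurable_causalExt {f : ℝ → ℝ} (hf : ContinuousOn f (Ici 0)) :
    Measurable (causalExt f) := by
  refine measurable_of_restrict_of_restrict_compl (measurableSet_Ici (a := (0 : ℝ))) ?_ ?_
  · have h : (Ici 0).domRestrict (causalExt f) = fun t => ENNReal.ofReal ((Ici 0).domRestrict f t) := by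
      ext t; exact causalExt_of_nonneg f t.2
    rw [h]
    exact ENNReal.measurable_ofReal.comp (continuousOn_iff_continuous_domRestrict.1 hf).measurable
  · have h : (Ici 0)ᶜ.domRestrict (causalExt f) = fun _ => 0 := by
      ext t; exact causalExt_of_neg f (by simpa using t.2)
    rw [h]
    exact measurable_const

/-- Convolution with `heaviside` is integration from time 0, so an integrated differential equation
becomes an identity in the convolution algebra. -/
theorem heaviside_lconvolution {g : ℝ → ℝ≥0∞} (hg : ∀ t < 0, g t = 0) (t : ℝ) :
    (heaviside ⋆ₗ g) t = ∫⁻ u in Ioc 0 t, g u := by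
  rw [lconvolution_comm, lconvolution_def, ← lintegral_indicator measurableSet_Ioc]
  have h0 : ∀ᵐ y : ℝ, y ≠ 0 := by simp [ae_iff]
  refine lintegral_congr_ae ?_
  filter_upwards [h0] with y hy
  rcases lt_or_gt_of_ne hy with h | h
  · rw [hg y h, zero_mul, indicator_of_notMem (by simp [h.le])]
  · by_cases hyt : y ≤ t
    · rw [indicator_of_mem (mem_Ioc.2 ⟨h, hyt⟩), heaviside_of_nonneg (by linarith), mul_one]
    · rw [indicator_of_notMem (by simp [hyt]), heaviside_of_neg (by linarith), mul_zero]

theorem heaviside_lconvolution_of_neg {g : ℝ → ℝ≥0∞} (hg : ∀ t < 0, g t = 0) {t : ℝ} (ht : t < 0) :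
    (heaviside ⋆ₗ g) t = 0 := by
  rw [heaviside_lconvolution hg, Ioc_eq_empty (by simpa using ht.le)]
  simp

theorem lintegral_Ioc_causalExt {x : ℝ → ℝ} (hx : ∀ t, 0 ≤ t → 0 ≤ x t)
    (hxc : ContinuousOn x (Ici 0)) {t : ℝ} (ht : 0 ≤ t) :
    ∫⁻ u in Ioc 0 t, causalExt x u = ENNReal.ofReal (∫ u in 0..t, x u) := by
  have hi : IntervalIntegrable x volume 0 t :=
    (hxc.mono (by rw [uIcc_of_le ht]; exact Icc_subset_Ici_self)).intervalIntegrable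
  rw [intervalIntegral.integral_of_le ht, ofReal_integral_eq_lintegral_ofReal
    ((intervalIntegrable_iff_integrableOn_Ioc_of_le ht).1 hi)]
  · exact setLIntegral_congr_fun measurableSet_Ioc fun u hu => causalExt_of_nonneg x hu.1.le
  · filter_upwards [ae_restrict_mem measurableSet_Ioc] with u hu using hx u hu.1.le

/-- The fundamental theorem of calculus with the loss term `y` moved to the left, because
subtraction in [0, ∞] truncates. -/
theorem causalExt_add_of_hasDerivWithinAt {f x y : ℝ → ℝ} (hf : ∀ t, 0 ≤ t → 0 ≤ f t)
    (hx : ∀ t, 0 ≤ t → 0 ≤ x t) (hy : ∀ t, 0 ≤ t → 0 ≤ y t)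
    (hxc : ContinuousOn x (Ici 0)) (hyc : ContinuousOn y (Ici 0))
    (hderiv : ∀ t, 0 ≤ t → HasDerivWithinAt f (x t - y t) (Ici 0) t) :
    causalExt f + heaviside ⋆ₗ causalExt y =
      ENNReal.ofReal (f 0) • heaviside + heaviside ⋆ₗ causalExt x := by
  ext t
  simp only [Pi.add_apply, Pi.smul_apply, smul_eq_mul]
  rcases lt_or_ge t 0 with ht | ht
  · simp [causalExt_of_neg _ ht, heaviside_of_neg ht,
      heaviside_lconvolution_of_neg (fun t => causalExt_of_neg x (t := t)) ht,
      heaviside_lconvolution_of_neg (fun t => causalExt_of_neg y (t := t)) ht]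
  have hsub : uIcc 0 t ⊆ Ici 0 := by rw [uIcc_of_le ht]; exact Icc_subset_Ici_self
  have hxi := (hxc.mono hsub).intervalIntegrable (μ := volume)
  have hyi := (hyc.mono hsub).intervalIntegrable (μ := volume)
  have hftc : ∫ u in 0..t, (x u - y u) = f t - f 0 := by
    refine intervalIntegral.integral_eq_sub_of_hasDeriv_right_of_le ht
      (fun u hu => ((hderiv u hu.1).continuousWithinAt).mono Icc_subset_Ici_self)
      (fun u hu => (hderiv u hu.1.le).mono ?_) (hxi.sub hyi)
    exact fun v hv => hu.1.le.trans (le_of_lt hv)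
  rw [intervalIntegral.integral_sub hxi hyi] at hftc
  rw [heaviside_lconvolution (fun t => causalExt_of_neg x (t := t)),
    heaviside_lconvolution (fun t => causalExt_of_neg y (t := t)),
    lintegral_Ioc_causalExt hx hxc ht, lintegral_Ioc_causalExt hy hyc ht,
    heaviside_of_nonneg ht, causalExt_of_nonneg _ ht, mul_one,
    ← ENNReal.ofReal_add (hf t ht) (intervalIntegral.integral_nonneg ht fun u hu => hy u hu.1),
    ← ENNReal.ofReal_add (hf 0 le_rfl) (intervalIntegral.integral_nonneg ht fun u hu => hx u hu.1)]
  congr 1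
  linarith

theorem intervalIntegrable_toReal {x : ℝ → ℝ≥0∞} (hx : Measurable x) {M : ℝ≥0∞} (hM : M ≠ ∞)
    (hxM : ∀ t, x t ≤ M) (s t : ℝ) : IntervalIntegrable (fun u => (x u).toReal) volume s t := by
  refine (intervalIntegrable_const (c := M.toReal)).mono_fun
    hx.ennreal_toReal.aestronglyMeasurable (ae_of_all _ fun u => ?_)
  beta_reduce
  rw [Real.norm_of_nonneg ENNReal.toReal_nonneg]
  exact (ENNReal.toReal_mono hM (hxM u)).trans (le_abs_self _)

theorem toReal_lintegral_Ioc {x : ℝ → ℝ≥0∞} (hx : Measurable x) {M : ℝ≥0∞} (hM : M ≠ ∞)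
    (hxM : ∀ t, x t ≤ M) {t : ℝ} (ht : 0 ≤ t) :
    (∫⁻ u in Ioc 0 t, x u).toReal = ∫ u in 0..t, (x u).toReal := by
  rw [intervalIntegral.integral_of_le ht, integral_toReal hx.aemeasurable]
  exact ae_of_all _ fun u => (hxM u).trans_lt hM.lt_top

theorem lintegral_Ioc_ne_top {x : ℝ → ℝ≥0∞} {M : ℝ≥0∞} (hM : M ≠ ∞)
    (hxM : ∀ t, x t ≤ M) (t : ℝ) : ∫⁻ u in Ioc 0 t, x u ≠ ∞ := by
  refine ((lintegral_mono hxM).trans_lt ?_).ne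
  rw [lintegral_const]
  exact ENNReal.mul_lt_top hM.lt_top (by simp)

/-! ### From the integrated equation back to the differential equation. -/

section

variable {g x y : ℝ → ℝ≥0∞} {δ M : ℝ≥0∞}

/-- The common bound `M` makes both integrals finite, which permits the return to real subtraction.
-/
theorem toReal_eq_of_causal (hx : Measurable x) (hy : Measurable y)
    (hx0 : ∀ t < 0, x t = 0) (hy0 : ∀ t < 0, y t = 0) (hM : M ≠ ∞)
    (hgM : ∀ t, g t ≤ M) (hxM : ∀ t, x t ≤ M) (hyM : ∀ t, y t ≤ M) (hδ : δ ≠ ∞)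
    (h : g + heaviside ⋆ₗ y = δ • heaviside + heaviside ⋆ₗ x) {t : ℝ} (ht : 0 ≤ t) :
    (g t).toReal = δ.toReal + (∫ u in 0..t, (x u).toReal) - ∫ u in 0..t, (y u).toReal := by
  have h1 := congrArg ENNReal.toReal (congrFun h t)
  simp only [Pi.add_apply, Pi.smul_apply, smul_eq_mul, heaviside_lconvolution hx0,
    heaviside_lconvolution hy0, heaviside_of_nonneg ht, mul_one] at h1
  rw [ENNReal.toReal_add ((hgM t).trans_lt hM.lt_top).ne (lintegral_Ioc_ne_top hM hyM t),
    ENNReal.toReal_add hδ (lintegral_Ioc_ne_top hM hxM t), toReal_lintegral_Ioc hx hM hxM ht,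
    toReal_lintegral_Ioc hy hM hyM ht] at h1
  linarith

/-- First half of a bootstrap: a primitive of bounded measurable functions is continuous. In the
application `x` and `y` are finite combinations of functions of the same kind as `g`, hence
continuous too, and the next lemma upgrades continuity to differentiability. -/
theorem continuousOn_toReal_of_causal (hx : Measurable x) (hy : Measurable y)
    (hx0 : ∀ t < 0, x t = 0) (hy0 : ∀ t < 0, y t = 0) (hM : M ≠ ∞)
    (hgM : ∀ t, g t ≤ M) (hxM : ∀ t, x t ≤ M) (hyM : ∀ t, y t ≤ M) (hδ : δ ≠ ∞)
    (h : g + heaviside ⋆ₗ y = δ • heaviside + heaviside ⋆ₗ x) :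
    ContinuousOn (fun t => (g t).toReal) (Ici 0) := by
  have hc : Continuous fun t : ℝ =>
      δ.toReal + (∫ u in 0..t, (x u).toReal) - ∫ u in 0..t, (y u).toReal :=
    (continuous_const.add (intervalIntegral.continuous_primitive
      (fun s t => intervalIntegrable_toReal hx hM hxM s t) 0)).sub
      (intervalIntegral.continuous_primitive
      (fun s t => intervalIntegrable_toReal hy hM hyM s t) 0)
  exact hc.continuousOn.congr fun t ht =>
    toReal_eq_of_causal hx hy hx0 hy0 hM hgM hxM hyM hδ h ht

theorem hasDerivWithinAt_toReal_of_causal (hx : Measurable x) (hy : Measurable y)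
    (hx0 : ∀ t < 0, x t = 0) (hy0 : ∀ t < 0, y t = 0) (hM : M ≠ ∞)
    (hgM : ∀ t, g t ≤ M) (hxM : ∀ t, x t ≤ M) (hyM : ∀ t, y t ≤ M) (hδ : δ ≠ ∞)
    (h : g + heaviside ⋆ₗ y = δ • heaviside + heaviside ⋆ₗ x)
    (hxc : ContinuousOn (fun t => (x t).toReal) (Ici 0))
    (hyc : ContinuousOn (fun t => (y t).toReal) (Ici 0)) {t : ℝ} (ht : 0 ≤ t) :
    HasDerivWithinAt (fun t => (g t).toReal) ((x t).toReal - (y t).toReal) (Ici 0) t := by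
  have key : ∀ z : ℝ → ℝ≥0∞, Measurable z → (∀ t, z t ≤ M) →
      ContinuousOn (fun t => (z t).toReal) (Ici 0) →
      HasDerivWithinAt (fun t => ∫ u in 0..t, (z u).toReal) (z t).toReal (Ici 0) t := by
    intro z hz hzM hzc
    have hi := intervalIntegrable_toReal hz hM hzM
    -- At 0 only the one-sided fundamental theorem is available; at positive times continuity is
    -- two-sided.
    rcases ht.eq_or_lt with rfl | htpos
    · exact intervalIntegral.integral_hasDerivWithinAt_right (hi 0 0) (s := Ici 0) (t := Ioi 0)
        (hz.ennreal_toReal.stronglyMeasurable.stronglyMeasurableAtFilter)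
        ((hzc 0 self_mem_Ici).mono Ioi_subset_Ici_self)
    · exact (intervalIntegral.integral_hasDerivAt_right (hi 0 t)
        (hz.ennreal_toReal.stronglyMeasurable.stronglyMeasurableAtFilter)
        (hzc.continuousAt (Ici_mem_nhds htpos))).hasDerivWithinAt
  refine (((key x hx hxM hxc).const_add δ.toReal).sub (key y hy hyM hyc)).congr
    (fun u hu => toReal_eq_of_causal hx hy hx0 hy0 hM hgM hxM hyM hδ h hu)
    (toReal_eq_of_causal hx hy hx0 hy0 hM hgM hxM hyM hδ h ht)

end

end Causal

/-! ### Transition functions with a row-finite generator -/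

section Generator

variable {ι : Type*} [DecidableEq ι]

/-- `q` has nonnegative off-diagonal and nonpositive diagonal entries, and the nonzero entries of
row `i` lie in the finite set `S i`. -/
structure IsRowFiniteGenerator (q : Matrix ι ι ℝ) (S : ι → Finset ι) : Prop where
  eq_zero : ∀ i k, k ∉ S i → q i k = 0
  off_diag : ∀ i k, k ≠ i → 0 ≤ q i k
  diag : ∀ i, q i i ≤ 0

variable {q : Matrix ι ι ℝ} {S : ι → Finset ι}

/-- `ENNReal.ofReal` truncates the nonpositive diagonal to 0, so the first sum collects the gain
rates and the diagonal reappears as the loss rate. If `i ∉ S i`, then the diagonal entry is 0 and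
nothing is lost. -/
theorem IsRowFiniteGenerator.sum_eq (hq : IsRowFiniteGenerator q S) (i : ι) (z : ι → ℝ) :
    ∑ k ∈ S i, q i k * z k =
      ∑ k ∈ S i, (ENNReal.ofReal (q i k)).toReal * z k -
        (ENNReal.ofReal (-q i i)).toReal * z i := by
  have h : ∀ k, (ENNReal.ofReal (q i k)).toReal * z k = q i k * z k +
      if k = i then -q i i * z i else 0 := by
    intro k
    by_cases hk : k = i
    · subst hk
      simp [ENNReal.ofReal_eq_zero.2 (hq.diag k)]
    · simp [hk, ENNReal.toReal_ofReal (hq.off_diag i k hk)]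
  simp only [h, Finset.sum_add_distrib, Finset.sum_ite_eq',
    ENNReal.toReal_ofReal (neg_nonneg.2 (hq.diag i))]
  split_ifs with hi
  · ring
  · rw [hq.eq_zero i i hi]; ring

theorem IsRowFiniteGenerator.tsum_eq (hq : IsRowFiniteGenerator q S) (i : ι) (z : ι → ℝ) :
    ∑' k, q i k * z k = ∑ k ∈ S i, (ENNReal.ofReal (q i k)).toReal * z k -
        (ENNReal.ofReal (-q i i)).toReal * z i := by
  rw [← hq.sum_eq, tsum_eq_sum fun k hk => by rw [hq.eq_zero i k hk, zero_mul]]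

/-- A solution of the backward equation solves the integrated backward equation. -/
theorem IsRowFiniteGenerator.integrated_backward (hq : IsRowFiniteGenerator q S)
    {F : ι → ι → ℝ → ℝ} (hF : ∀ i j t, 0 ≤ t → 0 ≤ F i j t)
    (hinit : ∀ i j, F i j 0 = if i = j then 1 else 0)
    (hderiv : ∀ i j t, 0 ≤ t → HasDerivWithinAt (F i j) (∑' k, q i k * F k j t) (Ici 0) t)
    (i j : ι) :
    causalExt (F i j) + ENNReal.ofReal (-q i i) • (heaviside ⋆ₗ causalExt (F i j)) =
      (if i = j then heaviside else 0) +
        ∑ k ∈ S i, ENNReal.ofReal (q i k) • (heaviside ⋆ₗ causalExt (F k j)) := by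
  have hc : ∀ i j, ContinuousOn (F i j) (Ici 0) := fun i j t ht =>
    (hderiv i j t ht).continuousWithinAt
  have hm : ∀ i j, Measurable (causalExt (F i j)) := fun i j => measurable_causalExt (hc i j)
  have hx : causalExt (fun t => ∑ k ∈ S i, (ENNReal.ofReal (q i k)).toReal * F k j t) =
      ∑ k ∈ S i, ENNReal.ofReal (q i k) • causalExt (F k j) := by
    ext t
    rw [Finset.sum_apply]
    simp only [Pi.smul_apply, smul_eq_mul]
    rcases lt_or_ge t 0 with ht | ht
    · simp [causalExt_of_neg _ ht]
    · simp only [causalExt_of_nonneg _ ht]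
      rw [ENNReal.ofReal_sum_of_nonneg fun k _ => mul_nonneg ENNReal.toReal_nonneg (hF k j t ht)]
      exact Finset.sum_congr rfl fun k _ => by
        rw [ENNReal.ofReal_mul ENNReal.toReal_nonneg, ENNReal.ofReal_toReal ENNReal.ofReal_ne_top]
  have hy : causalExt (fun t => (ENNReal.ofReal (-q i i)).toReal * F i j t) =
      ENNReal.ofReal (-q i i) • causalExt (F i j) := by
    ext t
    simp only [Pi.smul_apply, smul_eq_mul]
    rcases lt_or_ge t 0 with ht | ht
    · simp [causalExt_of_neg _ ht]
    · simp only [causalExt_of_nonneg _ ht]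
      rw [ENNReal.ofReal_mul ENNReal.toReal_nonneg, ENNReal.ofReal_toReal ENNReal.ofReal_ne_top]
  have key := causalExt_add_of_hasDerivWithinAt (f := F i j)
    (x := fun t => ∑ k ∈ S i, (ENNReal.ofReal (q i k)).toReal * F k j t)
    (y := fun t => (ENNReal.ofReal (-q i i)).toReal * F i j t)
    (hF i j) (fun t ht => Finset.sum_nonneg fun k _ => mul_nonneg ENNReal.toReal_nonneg (hF k j t ht))
    (fun t ht => mul_nonneg ENNReal.toReal_nonneg (hF i j t ht))
    (continuousOn_finsetSum _ fun k _ => continuousOn_const.mul (hc k j))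
    (continuousOn_const.mul (hc i j))
    (fun t ht => by rw [← hq.tsum_eq i (fun k => F k j t)]; exact hderiv i j t ht)
  rw [hx, hy, lconvolution_smul_right measurable_heaviside (hm _ _),
    lconvolution_sum_right _ measurable_heaviside (fun k => (hm _ _).const_smul _)] at key
  simp only [lconvolution_smul_right measurable_heaviside (hm _ _)] at key
  rw [key, hinit]
  split_ifs <;> simp

variable {ε : Type*} [Fintype ε]

/-- The matrix of the transitions from `a e` to `b e` at rate `c e`. -/
def jumpMatrix (a b : ε → ι) (c : ε → ℝ) : Matrix ι ι ℝ := fun i k =>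
  ∑ e, if i = a e ∧ k = b e then c e else 0

theorem jumpMatrix_transpose (a b : ε → ι) (c : ε → ℝ) (i j : ι) :
    jumpMatrix a b c i j = jumpMatrix b a c j i := by
  simp only [jumpMatrix, and_comm]

theorem tsum_add_jumpMatrix_mul (hq : IsRowFiniteGenerator q S) (a b : ε → ι) (c : ε → ℝ)
    (i : ι) (z : ι → ℝ) :
    ∑' k, (q + jumpMatrix a b c) i k * z k =
      ∑' k, q i k * z k + ∑ e, if i = a e then c e * z (b e) else 0 := by
  have h1 : Summable fun k => q i k * z k :=
    summable_of_ne_finset_zero (s := S i) fun k hk => by rw [hq.eq_zero i k hk, zero_mul]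
  have h2 : ∀ e, HasSum (fun k => (if i = a e ∧ k = b e then c e else 0) * z k)
      (if i = a e then c e * z (b e) else 0) := by
    intro e
    convert hasSum_single (b e) _ using 1
    · by_cases h : i = a e <;> simp [h]
    · intro k hk; simp [hk]
  have h3 := hasSum_sum (s := Finset.univ) fun e (_ : e ∈ Finset.univ) => h2 e
  have h4 := h1.hasSum.add h3
  rw [← h4.tsum_eq]
  refine tsum_congr fun k => ?_
  rw [Matrix.add_apply, jumpMatrix, add_mul, Finset.sum_mul]

/-- A bounded causal solution of the integrated backward equation is differentiable and solves the
backward equation. -/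
theorem IsRowFiniteGenerator.hasDerivWithinAt_backward (hq : IsRowFiniteGenerator q S)
    {a b : ε → ι} {c : ε → ℝ} (hc : ∀ e, 0 ≤ c e)
    {p : ι → ι → ℝ → ℝ≥0∞} (hp : ∀ i j, Measurable (p i j)) (hp0 : ∀ i j, ∀ t < 0, p i j t = 0)
    (hp1 : ∀ i j t, p i j t ≤ 1)
    (hback : ∀ i j, p i j + ENNReal.ofReal (-q i i) • (heaviside ⋆ₗ p i j) =
      (if i = j then heaviside else 0) +
        (∑ k ∈ S i, ENNReal.ofReal (q i k) • (heaviside ⋆ₗ p k j) +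
        ∑ e, if i = a e then ENNReal.ofReal (c e) • (heaviside ⋆ₗ p (b e) j) else 0))
    (i j : ι) {t : ℝ} (ht : 0 ≤ t) :
    HasDerivWithinAt (fun u => (p i j u).toReal)
      (∑' k, (q + jumpMatrix a b c) i k * (p k j t).toReal) (Ici 0) t := by
  -- Gain part `x` and loss part `y` of the right-hand side: the equation to be proved is p' = x -
  -- y.
  set x : ι → ι → ℝ → ℝ≥0∞ := fun i j => ∑ k ∈ S i, ENNReal.ofReal (q i k) • p k j +
    ∑ e, if i = a e then ENNReal.ofReal (c e) • p (b e) j else 0 with hx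
  set y : ι → ι → ℝ → ℝ≥0∞ := fun i j => ENNReal.ofReal (-q i i) • p i j with hy
  have hH := measurable_heaviside
  have hm1 : ∀ i j, Measurable (∑ k ∈ S i, ENNReal.ofReal (q i k) • p k j) := fun i j =>
    Finset.sum_induction _ Measurable (fun _ _ => Measurable.add) measurable_zero
      fun k _ => (hp k j).const_smul _
  have hm2' : ∀ i j e, Measurable (if i = a e then ENNReal.ofReal (c e) • p (b e) j else 0) := by
    intro i j e
    split_ifs
    · exact (hp _ _).const_smul _
    · exact measurable_zero
  have hm2 : ∀ i j, Measurable
      (∑ e, if i = a e then ENNReal.ofReal (c e) • p (b e) j else 0) := fun i j =>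
    Finset.sum_induction _ Measurable (fun _ _ => Measurable.add) measurable_zero
      fun e _ => hm2' i j e
  have hxm : ∀ i j, Measurable (x i j) := fun i j => (hm1 i j).add (hm2 i j)
  have hym : ∀ i j, Measurable (y i j) := fun i j => (hp i j).const_smul _
  have hxval : ∀ i j t, x i j t = ∑ k ∈ S i, ENNReal.ofReal (q i k) * p k j t +
      ∑ e, if i = a e then ENNReal.ofReal (c e) * p (b e) j t else 0 := by
    intro i j t
    simp only [hx, Pi.add_apply, Finset.sum_apply, Pi.smul_apply, smul_eq_mul]
    congr 1
    refine Finset.sum_congr rfl fun e _ => ?_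
    split_ifs <;> simp
  have hyval : ∀ i j t, y i j t = ENNReal.ofReal (-q i i) * p i j t := fun i j t => rfl
  have hx0 : ∀ i j, ∀ t < 0, x i j t = 0 := by
    intro i j t ht; rw [hxval]; simp [hp0 _ _ t ht]
  have hy0 : ∀ i j, ∀ t < 0, y i j t = 0 := by
    intro i j t ht; rw [hyval]; simp [hp0 _ _ t ht]
  -- One finite constant per row dominates all three functions, since `p ≤ 1`: the summand 1 is for
  -- `p`, the total of the gain rates for `x`, the loss rate for `y`.
  set M : ι → ℝ≥0∞ := fun i => 1 + (∑ k ∈ S i, ENNReal.ofReal (q i k) +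
    ∑ e, ENNReal.ofReal (c e)) + ENNReal.ofReal (-q i i) with hMdef
  have hM : ∀ i, M i ≠ ∞ := by
    intro i
    simp [hMdef, ENNReal.add_eq_top, ENNReal.sum_eq_top]
  have hpM : ∀ i j t, p i j t ≤ M i := fun i j t =>
    (hp1 i j t).trans ((self_le_add_right _ _).trans (self_le_add_right _ _))
  have hxM : ∀ i j t, x i j t ≤ M i := by
    intro i j t
    refine le_trans ?_ ((self_le_add_left _ 1).trans (self_le_add_right _ _))
    rw [hxval]
    gcongr with k hk e he
    · exact mul_le_of_le_one_right' (hp1 _ _ _)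
    · split_ifs
      · exact mul_le_of_le_one_right' (hp1 _ _ _)
      · exact zero_le
  have hyM : ∀ i j t, y i j t ≤ M i := fun i j t =>
    (mul_le_of_le_one_right' (hp1 _ _ _)).trans (self_le_add_left _ _)
  have hδ : ∀ i j : ι, (if i = j then (1 : ℝ≥0∞) else 0) ≠ ∞ := by
    intro i j; split_ifs <;> simp
  have hid : ∀ i j, p i j + heaviside ⋆ₗ y i j =
      (if i = j then (1 : ℝ≥0∞) else 0) • heaviside + heaviside ⋆ₗ x i j := by
    intro i j
    rw [hy, hx]
    simp only
    rw [lconvolution_smul_right hH (hp _ _), hback, lconvolution_add_right hH (hm1 i j),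
      lconvolution_sum_right _ hH (fun k => (hp _ _).const_smul _),
      lconvolution_sum_right _ hH (fun e => hm2' i j e)]
    simp only [lconvolution_smul_right hH (hp _ _)]
    congr 1
    · split_ifs <;> simp
    · congr 1
      refine Finset.sum_congr rfl fun e _ => ?_
      split_ifs
      · rw [lconvolution_smul_right hH (hp _ _)]
      · rw [lconvolution_zero]
  have hcont : ∀ i j, ContinuousOn (fun t => (p i j t).toReal) (Ici 0) := fun i j =>
    continuousOn_toReal_of_causal (hxm i j) (hym i j) (hx0 i j) (hy0 i j) (hM i) (hpM i j)
      (hxM i j) (hyM i j) (hδ i j) (hid i j)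
  have hpt : ∀ i j t, p i j t ≠ ∞ := fun i j t => ((hp1 i j t).trans_lt ENNReal.one_lt_top).ne
  have hxreal : ∀ t, (x i j t).toReal = ∑ k ∈ S i, (ENNReal.ofReal (q i k)).toReal * (p k j t).toReal
      + ∑ e, if i = a e then c e * (p (b e) j t).toReal else 0 := by
    intro t
    have h1 : ∀ k ∈ S i, ENNReal.ofReal (q i k) * p k j t ≠ ∞ := fun k _ =>
      ENNReal.mul_ne_top ENNReal.ofReal_ne_top (hpt _ _ _)
    have h2 : ∀ e ∈ Finset.univ,
        (if i = a e then ENNReal.ofReal (c e) * p (b e) j t else 0) ≠ ∞ := by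
      intro e _
      split_ifs
      · exact ENNReal.mul_ne_top ENNReal.ofReal_ne_top (hpt _ _ _)
      · simp
    rw [hxval, ENNReal.toReal_add (ENNReal.sum_ne_top.2 h1) (ENNReal.sum_ne_top.2 h2),
      ENNReal.toReal_sum h1, ENNReal.toReal_sum h2]
    simp only [ENNReal.toReal_mul]
    congr 1
    refine Finset.sum_congr rfl fun e _ => ?_
    split_ifs
    · rw [ENNReal.toReal_mul, ENNReal.toReal_ofReal (hc e)]
    · simp
  have hyreal : ∀ t, (y i j t).toReal = (ENNReal.ofReal (-q i i)).toReal * (p i j t).toReal :=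
    fun t => by rw [hyval, ENNReal.toReal_mul]
  have key := hasDerivWithinAt_toReal_of_causal (hxm i j) (hym i j) (hx0 i j) (hy0 i j) (hM i)
    (hpM i j) (hxM i j) (hyM i j) (hδ i j) (hid i j) (by
      simp only [hxreal]
      refine (continuousOn_finsetSum _ fun k _ => continuousOn_const.mul (hcont k j)).add
        (continuousOn_finsetSum _ fun e _ => ?_)
      split_ifs
      · exact continuousOn_const.mul (hcont _ j)
      · exact continuousOn_const) (by
      simp only [hyreal]
      exact continuousOn_const.mul (hcont i j)) ht
  rw [hxreal, hyreal] at key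
  rw [tsum_add_jumpMatrix_mul hq, hq.tsum_eq]
  convert key using 1
  ring

end Generator

/-! ### Transition functions as causal kernels. -/

section TransitionFunction

variable {ι : Type*} [DecidableEq ι] {q : Matrix ι ι ℝ} {P : ℝ → Matrix ι ι ℝ}

theorem IsTransitionFunction.continuousOn (hP : IsTransitionFunction q P) (i j : ι) :
    ContinuousOn (fun t => P t i j) (Ici 0) := fun t ht =>
  (hP.backward t ht i j).continuousWithinAt

theorem IsTransitionFunction.measurable_causalExt (hP : IsTransitionFunction q P) (i j : ι) :
    Measurable (causalExt fun t => P t i j) :=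
  BirthDeath.measurable_causalExt (hP.continuousOn i j)

theorem IsTransitionFunction.tsum_causalExt_le (hP : IsTransitionFunction q P) (i : ι) (t : ℝ) :
    ∑' j, causalExt (fun t => P t i j) t ≤ heaviside t := by
  rcases lt_or_ge t 0 with ht | ht
  · simp [causalExt_of_neg _ ht]
  · simp only [causalExt_of_nonneg _ ht, heaviside_of_nonneg ht]
    rw [← ENNReal.ofReal_tsum_of_nonneg (hP.nonneg t ht i) (hP.summable_row t ht i)]
    exact ENNReal.ofReal_le_one.2 (hP.row_le_one t ht i)

theorem heaviside_le_one (t : ℝ) : heaviside t ≤ 1 := by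
  rcases lt_or_ge t 0 with ht | ht
  · simp [heaviside_of_neg ht]
  · rw [heaviside_of_nonneg ht]

theorem IsTransitionFunction.causalExt_le_one (hP : IsTransitionFunction q P) (i j : ι) (t : ℝ) :
    causalExt (fun t => P t i j) t ≤ 1 :=
  (ENNReal.le_tsum j).trans ((hP.tsum_causalExt_le i t).trans (heaviside_le_one t))

theorem IsTransitionFunction.causalExt_add_time (hP : IsTransitionFunction q P) (s : ℝ) (hs : 0 ≤ s)
    (t : ℝ) (ht : 0 ≤ t) (i j : ι) :
    causalExt (fun t => P t i j) (s + t) =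
      ∑' k, causalExt (fun t => P t i k) s * causalExt (fun t => P t k j) t := by
  have hle : ∀ k, P t k j ≤ 1 := fun k =>
    ((hP.summable_row t ht k).le_tsum j fun _ _ => hP.nonneg t ht k _).trans (hP.row_le_one t ht k)
  simp only [causalExt_of_nonneg _ hs, causalExt_of_nonneg _ ht,
    causalExt_of_nonneg _ (add_nonneg hs ht), hP.chapman_kolmogorov s hs t ht i j,
    ← ENNReal.ofReal_mul (hP.nonneg s hs i _)]
  refine ENNReal.ofReal_tsum_of_nonneg
    (fun k => mul_nonneg (hP.nonneg s hs _ _) (hP.nonneg t ht _ _)) ?_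
  exact (hP.summable_row s hs i).of_nonneg_of_le
    (fun k => mul_nonneg (hP.nonneg s hs _ _) (hP.nonneg t ht _ _))
    (fun k => mul_le_of_le_one_right (hP.nonneg s hs _ _) (hle k))

theorem IsTransitionFunction.integrated_backward (hP : IsTransitionFunction q P)
    {S : ι → Finset ι} (hq : IsRowFiniteGenerator q S) (i j : ι) :
    (causalExt fun t => P t i j) +
        ENNReal.ofReal (-q i i) • (heaviside ⋆ₗ causalExt fun t => P t i j) =
      (if i = j then heaviside else 0) +
        ∑ k ∈ S i, ENNReal.ofReal (q i k) • (heaviside ⋆ₗ causalExt fun t => P t k j) :=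
  hq.integrated_backward (F := fun i j t => P t i j) (fun i j t ht => hP.nonneg t ht i j)
    (fun i j => by simp [hP.zero, Matrix.one_apply]) (fun i j t ht => hP.backward t ht i j) i j

/-- The forward equation is the backward equation of the transposed kernel for the transposed
generator. -/
theorem IsTransitionFunction.integrated_forward (hP : IsTransitionFunction q P)
    {S : ι → Finset ι} (hq : IsRowFiniteGenerator q.transpose S) (i j : ι) :
    (causalExt fun t => P t j i) +
        ENNReal.ofReal (-q i i) • (heaviside ⋆ₗ causalExt fun t => P t j i) =
      (if i = j then heaviside else 0) +
        ∑ k ∈ S i, ENNReal.ofReal (q k i) • (heaviside ⋆ₗ causalExt fun t => P t j k) :=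
  hq.integrated_backward (F := fun i j t => P t j i) (fun i j t ht => hP.nonneg t ht j i)
    (fun i j => by simp [hP.zero, Matrix.one_apply, eq_comm])
    (fun i j t ht => by simpa only [mul_comm, Matrix.transpose_apply] using hP.forward t ht j i) i j

end TransitionFunction

/-! ### Perturbation of a transition function by finitely many transitions -/

section Perturbation

variable {ι : Type*} [DecidableEq ι] {ε : Type*} [Fintype ε] {q : Matrix ι ι ℝ}
  {P : ℝ → Matrix ι ι ℝ} {S : ι → Finset ι} {a : ε → ι} {c : ε → ℝ}

theorem IsTransitionFunction.heaviside_lconvolution_toReal (hP : IsTransitionFunction q P) (i j : ι)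
    {t : ℝ} (ht : 0 ≤ t) :
    (heaviside ⋆ₗ causalExt fun t => P t i j) t = ENNReal.ofReal (∫ u in 0..t, P u i j) := by
  rw [heaviside_lconvolution fun t => causalExt_of_neg _]
  exact lintegral_Ioc_causalExt (fun t ht => hP.nonneg t ht i j) (hP.continuousOn i j) ht

theorem IsTransitionFunction.tsum_add_time [Countable ι] (hP : IsTransitionFunction q P)
    (s : ℝ) (hs : 0 ≤ s) (t : ℝ) (ht : 0 ≤ t) (i : ι) :
    ∑' j, causalExt (fun t => P t i j) (s + t) =
      ∑' k, causalExt (fun t => P t i k) s * ∑' j, causalExt (fun t => P t k j) t := by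
  simp only [hP.causalExt_add_time s hs t ht, ← ENNReal.tsum_mul_left]
  exact ENNReal.tsum_comm

/-- By Chapman–Kolmogorov the row sum at time `t` is the row at time `s` weighted by row sums at
time `t - s`, each at most one. -/
theorem IsTransitionFunction.tsum_antitone [Countable ι] (hP : IsTransitionFunction q P) (i : ι)
    {s t : ℝ} (hs : 0 ≤ s)
    (hst : s ≤ t) :
    ∑' j, causalExt (fun t => P t i j) t ≤ ∑' j, causalExt (fun t => P t i j) s := by
  have h := hP.tsum_add_time s hs (t - s) (by linarith) i
  rw [add_sub_cancel] at h
  rw [h]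
  refine ENNReal.tsum_le_tsum fun k => mul_le_of_le_one_right' ?_
  exact (hP.tsum_causalExt_le k _).trans (heaviside_le_one _)

/-- For small times the survival probability decreases at least at the killing rate. -/
theorem IsTransitionFunction.tsum_add_kill_le [Countable ι]
    (hP : IsTransitionFunction q P) (hq : IsRowFiniteGenerator q S)
    (hc : ∀ e, 0 ≤ c e) (hkill : ∀ i, ∑ k ∈ S i, q i k + ∑ e, (if i = a e then c e else 0) ≤ 0)
    (k : ι) {h V : ℝ} (hh : 0 ≤ h)
    (hV : ∀ e, -q (a e) (a e) ≤ V) (hV0 : 0 ≤ V) :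
    ∑' j, causalExt (fun t => P t k j) h +
      ∑ e, (if k = a e then ENNReal.ofReal (c e * h / (1 + V * h)) else 0) ≤ 1 := by
  set f : ι → ℝ → ℝ≥0∞ := fun k t => ∑' j, causalExt (fun t => P t k j) t with hf
  have hfH : ∀ k t, f k t ≤ heaviside t := hP.tsum_causalExt_le
  have hf1 : ∀ k t, f k t ≤ 1 := fun k t => (hfH k t).trans (heaviside_le_one t)
  -- `V` controls the exit rate only at the sources `a e`. At any other state the second sum is zero
  -- and substochasticity suffices.
  by_cases hka : ∃ e, k = a e
  swap
  · push Not at hka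
    simpa [hka] using hf1 k h
  have hkV : -q k k ≤ V := by obtain ⟨e, rfl⟩ := hka; exact hV e
  have hf0 : ∀ k, ∀ t < 0, f k t = 0 := fun k t ht => by
    simp [hf, causalExt_of_neg _ ht]
  have hm := hP.measurable_causalExt
  have hH := measurable_heaviside
  -- The integrated backward equation summed over the final state `j`.
  have hsum : f k h + ENNReal.ofReal (-q k k) * (heaviside ⋆ₗ f k) h =
      1 + ∑ l ∈ S k, ENNReal.ofReal (q k l) * (heaviside ⋆ₗ f l) h := by
    have h1 : ∀ j, causalExt (fun t => P t k j) h +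
        ENNReal.ofReal (-q k k) * (heaviside ⋆ₗ causalExt fun t => P t k j) h =
        (if k = j then 1 else 0) + ∑ l ∈ S k, ENNReal.ofReal (q k l) *
          (heaviside ⋆ₗ causalExt fun t => P t l j) h := by
      intro j
      have := congrFun (hP.integrated_backward hq k j) h
      simp only [Pi.add_apply, Finset.sum_apply, Pi.smul_apply, smul_eq_mul] at this
      rw [this]
      congr 1
      split_ifs
      · rw [heaviside_of_nonneg hh]
      · rfl
    have h2 : ∑' j, _ = ∑' j, _ := tsum_congr h1
    rw [ENNReal.summable.tsum_add ENNReal.summable, ENNReal.summable.tsum_add ENNReal.summable,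
      Summable.tsum_finsetSum (fun _ _ => ENNReal.summable)] at h2
    simp only [ENNReal.tsum_mul_left] at h2
    simp only [← lconvolution_tsum_right hH (hm _)] at h2
    rw [tsum_ite_eq' k (fun _ => (1 : ℝ≥0∞))] at h2
    exact h2
  -- The loss integral is bounded below by monotonicity of `f k`, the gain integrals above by `f l ≤
  -- 1`.
  have hlow : ENNReal.ofReal h * f k h ≤ (heaviside ⋆ₗ f k) h := by
    rw [heaviside_lconvolution (hf0 k)]
    calc ENNReal.ofReal h * f k h = ∫⁻ _ in Ioc 0 h, f k h := by
          rw [setLIntegral_const, Real.volume_Ioc, sub_zero, mul_comm]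
      _ ≤ _ := setLIntegral_mono' measurableSet_Ioc fun u hu => hP.tsum_antitone k hu.1.le hu.2
  have hupp : ∀ l, (heaviside ⋆ₗ f l) h ≤ ENNReal.ofReal h := by
    intro l
    rw [heaviside_lconvolution (hf0 l)]
    calc _ ≤ ∫⁻ _ in Ioc 0 h, 1 := lintegral_mono fun u => hf1 l u
      _ = _ := by rw [setLIntegral_const, Real.volume_Ioc, sub_zero, one_mul]
  have hineq : f k h + ENNReal.ofReal (-q k k) * (ENNReal.ofReal h * f k h) ≤
      1 + ∑ l ∈ S k, ENNReal.ofReal (q k l) * ENNReal.ofReal h := by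
    calc _ ≤ f k h + ENNReal.ofReal (-q k k) * (heaviside ⋆ₗ f k) h := by gcongr
      _ = _ := hsum
      _ ≤ _ := by gcongr with l; exact hupp l
  have hft : f k h ≠ ∞ := ((hf1 k h).trans_lt ENNReal.one_lt_top).ne
  set φ := (f k h).toReal with hφ
  have hfφ : f k h = ENNReal.ofReal φ := (ENNReal.ofReal_toReal hft).symm
  have hφ0 : 0 ≤ φ := ENNReal.toReal_nonneg
  set κ := ∑ e, (if k = a e then c e else 0) with hκ
  have hκ0 : 0 ≤ κ := Finset.sum_nonneg fun e _ => by split_ifs; exacts [hc e, le_rfl]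
  have hv0 : 0 ≤ -q k k := neg_nonneg.2 (hq.diag k)
  have hreal : φ + -q k k * (h * φ) ≤ 1 + (∑ l ∈ S k, (ENNReal.ofReal (q k l)).toReal) * h := by
    have := ENNReal.toReal_mono (by
      simp [ENNReal.add_eq_top, ENNReal.sum_eq_top, ENNReal.mul_eq_top]) hineq
    rw [hfφ, ENNReal.toReal_add (by simp) (by simp [ENNReal.mul_eq_top]),
      ENNReal.toReal_add (by simp) (by simp [ENNReal.sum_eq_top, ENNReal.mul_eq_top]),
      ENNReal.toReal_sum (by simp [ENNReal.mul_eq_top])] at this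
    simpa only [ENNReal.toReal_mul, ENNReal.toReal_ofReal hφ0, ENNReal.toReal_ofReal hv0,
      ENNReal.toReal_ofReal hh, ENNReal.toReal_one, Finset.sum_mul] using this
  have hrow := hq.sum_eq k (fun _ => 1)
  simp only [mul_one, ENNReal.toReal_ofReal hv0] at hrow
  have hkk := hkill k
  rw [hrow] at hkk
  -- With v = -q k k, `hkill` bounds the sum of the gain rates by v - κ, whence φ(1 + vh) ≤ 1 + vh -
  -- κh. Division by 1 + vh gives the loss κh/(1 + vh), and v ≤ V makes the estimate uniform over
  -- the sources.
  have hmain : φ + κ * h / (1 + V * h) ≤ 1 := by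
    have h1 : φ * (1 + -q k k * h) ≤ 1 + -q k k * h - κ * h := by nlinarith
    have hpos : 0 < 1 + -q k k * h := by positivity
    have h2 : κ * h / (1 + V * h) ≤ κ * h / (1 + -q k k * h) := by gcongr
    have h3 : φ ≤ 1 - κ * h / (1 + -q k k * h) := by
      rw [le_sub_iff_add_le, ← le_sub_iff_add_le', div_le_iff₀ hpos]
      linarith
    linarith
  have hθ : ∑ e, (if k = a e then ENNReal.ofReal (c e * h / (1 + V * h)) else 0) =
      ENNReal.ofReal (κ * h / (1 + V * h)) := by
    rw [hκ, Finset.sum_mul, Finset.sum_div, ENNReal.ofReal_sum_of_nonneg]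
    · refine Finset.sum_congr rfl fun e _ => ?_
      split_ifs <;> simp
    · intro e _
      have := hc e
      split_ifs <;> positivity
  change f k h + _ ≤ 1
  rw [hθ, hfφ, ← ENNReal.ofReal_add hφ0 (by positivity)]
  exact ENNReal.ofReal_le_one.2 hmain

/-- The probability of survival plus the probability of being killed through one of the given
channels is at most one. -/
theorem IsTransitionFunction.tsum_add_integral_le [Countable ι]
    (hP : IsTransitionFunction q P) (hq : IsRowFiniteGenerator q S)
    (hc : ∀ e, 0 ≤ c e) (hkill : ∀ i, ∑ k ∈ S i, q i k + ∑ e, (if i = a e then c e else 0) ≤ 0)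
    (i : ι) {T : ℝ} (hT : 0 ≤ T) :
    ∑' j, causalExt (fun t => P t i j) T +
      ∑ e, ENNReal.ofReal (c e) * ((causalExt fun t => P t i (a e)) ⋆ₗ heaviside) T ≤ 1 := by
  set f : ℝ → ℝ≥0∞ := fun t => ∑' j, causalExt (fun t => P t i j) t with hf
  have hf1 : ∀ t, f t ≤ 1 := fun t => (hP.tsum_causalExt_le i t).trans (heaviside_le_one t)
  have hft : ∀ t, f t ≠ ∞ := fun t => ((hf1 t).trans_lt ENNReal.one_lt_top).ne
  have hfm : Measurable f := Measurable.tsum fun j => hP.measurable_causalExt i j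
  set φ : ℝ → ℝ := fun t => (f t).toReal with hφ
  have hφ1 : ∀ t, φ t ≤ 1 := fun t => ENNReal.toReal_le_of_le_ofReal zero_le_one (by simpa using hf1 t)
  have hφanti : ∀ s t, 0 ≤ s → s ≤ t → φ t ≤ φ s := fun s t hs hst =>
    ENNReal.toReal_mono (hft s) (hP.tsum_antitone i hs hst)
  have hφi : ∀ s t, IntervalIntegrable φ volume s t :=
    intervalIntegrable_toReal hfm ENNReal.one_ne_top hf1
  set I : ε → ℝ → ℝ := fun e t => ∫ u in 0..t, P u i (a e) with hI
  have hPi : ∀ e s t, 0 ≤ s → 0 ≤ t → IntervalIntegrable (fun u => P u i (a e)) volume s t := by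
    intro e s t hs ht
    refine ((hP.continuousOn i (a e)).mono fun u hu => ?_).intervalIntegrable
    exact (le_min hs ht).trans hu.1
  set V := ∑ e, -q (a e) (a e) with hVdef
  have hdiag : ∀ e, 0 ≤ -q (a e) (a e) := fun e => neg_nonneg.2 (hq.diag _)
  have hV0 : 0 ≤ V := Finset.sum_nonneg fun e _ => hdiag e
  have hV : ∀ e, -q (a e) (a e) ≤ V := fun e =>
    Finset.single_le_sum (f := fun e => -q (a e) (a e)) (fun e _ => hdiag e) (Finset.mem_univ e)
  -- Chapman–Kolmogorov up to time `s`, then the short-time estimate over `h` from each intermediate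
  -- state.
  have step : ∀ h s, 0 < h → 0 ≤ s →
      φ (s + h) + ∑ e, P s i (a e) * (c e * h / (1 + V * h)) ≤ φ s := by
    intro h s hh hs
    have hE : f (s + h) + ∑ e, causalExt (fun t => P t i (a e)) s *
        ENNReal.ofReal (c e * h / (1 + V * h)) ≤ f s := by
      calc _ = ∑' k, causalExt (fun t => P t i k) s * (∑' j, causalExt (fun t => P t k j) h +
            ∑ e, (if k = a e then ENNReal.ofReal (c e * h / (1 + V * h)) else 0)) := by
            simp only [mul_add, Finset.mul_sum]
            rw [ENNReal.summable.tsum_add ENNReal.summable, ← hP.tsum_add_time s hs h hh.le i,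
              Summable.tsum_finsetSum (fun _ _ => ENNReal.summable)]
            congr 1
            refine Finset.sum_congr rfl fun e _ => ?_
            rw [tsum_eq_single (a e)]
            · simp
            · intro k hk; simp [hk]
        _ ≤ ∑' k, causalExt (fun t => P t i k) s := by
            refine ENNReal.tsum_le_tsum fun k => mul_le_of_le_one_right' ?_
            exact hP.tsum_add_kill_le hq hc hkill k hh.le hV hV0
    have hθ : ∀ e, 0 ≤ c e * h / (1 + V * h) := fun e => by have := hc e; positivity
    have hR := ENNReal.toReal_mono (hft s) hE
    simp only [causalExt_of_nonneg _ hs] at hR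
    rw [ENNReal.toReal_add (hft _) (by simp [ENNReal.sum_eq_top, ENNReal.mul_eq_top]),
      ENNReal.toReal_sum (by simp [ENNReal.mul_eq_top])] at hR
    simpa only [ENNReal.toReal_mul, ENNReal.toReal_ofReal (hP.nonneg s hs i _),
      ENNReal.toReal_ofReal (hθ _)] using hR
  -- Integrating `step` over `s ∈ [0, t]` cancels the bulk of the two integrals of `φ`. There remain
  -- ∫_0^h φ ≤ h and ∫_t^{t+h} φ ≥ h φ(t + h); a factor `h` then divides out.
  have integrated : ∀ h t, 0 < h → 0 ≤ t → ∑ e, c e * I e t ≤ (1 + V * h) * (1 - φ (t + h)) := by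
    intro h t hh ht
    have hshift : IntervalIntegrable (fun s => φ (s + h)) volume 0 t :=
      intervalIntegrable_toReal (hfm.comp (measurable_add_const h)) ENNReal.one_ne_top
        (fun u => hf1 _) 0 t
    have hterm : ∀ e, IntervalIntegrable (fun s => P s i (a e) * (c e * h / (1 + V * h)))
        volume 0 t := fun e => (hPi e 0 t le_rfl ht).mul_const _
    have hsumi : IntervalIntegrable (fun s => ∑ e, P s i (a e) * (c e * h / (1 + V * h)))
        volume 0 t := by
      simpa only [Finset.sum_fn] using IntervalIntegrable.sum Finset.univ fun e _ => hterm e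
    have hint : ∫ s in 0..t, (φ (s + h) + ∑ e, P s i (a e) * (c e * h / (1 + V * h))) ≤
        ∫ s in 0..t, φ s := by
      exact intervalIntegral.integral_mono_on ht (hshift.add hsumi) (hφi 0 t)
        fun s hs => step h s hh hs.1
    rw [intervalIntegral.integral_add hshift hsumi,
      intervalIntegral.integral_comp_add_right, zero_add,
      intervalIntegral.integral_finsetSum (fun e _ => hterm e)] at hint
    simp only [intervalIntegral.integral_mul_const] at hint
    have hsplit : (∫ s in h..(t + h), φ s) =
        (∫ s in 0..t, φ s) + (∫ s in t..(t + h), φ s) - ∫ s in 0..h, φ s := by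
      have h1 := intervalIntegral.integral_add_adjacent_intervals (hφi 0 t) (hφi t (t + h))
      have h2 := intervalIntegral.integral_add_adjacent_intervals (hφi 0 h) (hφi h (t + h))
      linarith
    have hlow : h * φ (t + h) ≤ ∫ s in t..(t + h), φ s := by
      have := intervalIntegral.integral_mono_on (μ := volume) (f := fun _ => φ (t + h)) (g := φ)
        (by linarith : t ≤ t + h) intervalIntegrable_const (hφi _ _)
        fun s hs => hφanti s (t + h) (ht.trans hs.1) hs.2
      simpa using this
    have hupp : ∫ s in 0..h, φ s ≤ h := by
      have := intervalIntegral.integral_mono_on (μ := volume) (f := φ) (g := fun _ => 1)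
        hh.le (hφi _ _) intervalIntegrable_const fun s hs => hφ1 s
      simpa using this
    have hsum : ∑ e, I e t * (c e * h / (1 + V * h)) = h * ((∑ e, c e * I e t) / (1 + V * h)) := by
      rw [Finset.sum_div, Finset.mul_sum]
      exact Finset.sum_congr rfl fun e _ => by ring
    have h3 : h * ((∑ e, c e * I e t) / (1 + V * h)) ≤ h * (1 - φ (t + h)) := by
      rw [← hsum]; linarith
    have h4 := le_of_mul_le_mul_left h3 hh
    rw [div_le_iff₀ (by positivity)] at h4
    linarith
  -- The occupation integrals are 1-Lipschitz because P ≤ 1. This allows `integrated` to be used at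
  -- time `T - h`, so that `φ` is evaluated exactly at `T` and no continuity of `φ` is needed.
  have hIlip : ∀ e h, 0 ≤ h → h ≤ T → I e T ≤ I e (T - h) + h := by
    intro e h hh hhT
    have h1 := intervalIntegral.integral_add_adjacent_intervals
      (hPi e 0 (T - h) le_rfl (by linarith)) (hPi e (T - h) T (by linarith) hT)
    have h2 := intervalIntegral.integral_mono_on (μ := volume) (f := fun u => P u i (a e))
      (g := fun _ => 1) (by linarith : T - h ≤ T) (hPi e (T - h) T (by linarith) hT)
      intervalIntegrable_const fun s hs => by
        have hs0 : 0 ≤ s := le_trans (by linarith) hs.1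
        have := hP.causalExt_le_one i (a e) s
        rw [causalExt_of_nonneg _ hs0] at this
        exact ENNReal.ofReal_le_one.1 this
    have h3 : ∫ u in (T - h)..T, (1 : ℝ) = h := by simp
    rw [h3] at h2
    simp only [hI]
    linarith
  have hfinal : φ T + ∑ e, c e * I e T ≤ 1 := by
    rcases hT.eq_or_lt with rfl | hTpos
    · simpa [hI] using hφ1 0
    refine le_of_forall_pos_le_add fun η hη => ?_
    set K := V + ∑ e, c e with hK
    have hK0 : 0 ≤ K := add_nonneg hV0 (Finset.sum_nonneg fun e _ => hc e)
    -- The total error is at most hK: the part Vh(1 - φ) comes from the factor 1 + Vh, the part (∑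
    -- c)h from `hIlip`. The minimum keeps `T - h` nonnegative, and `K + 1` avoids division by zero.
    set h := min T (η / (K + 1)) with hhdef
    have hh : 0 < h := lt_min hTpos (by positivity)
    have h1 := integrated h (T - h) hh (by linarith [min_le_left T (η / (K + 1))])
    rw [sub_add_cancel] at h1
    have h2 : ∑ e, c e * I e T ≤ ∑ e, c e * I e (T - h) + (∑ e, c e) * h := by
      rw [Finset.sum_mul, ← Finset.sum_add_distrib]
      refine Finset.sum_le_sum fun e _ => ?_
      rw [← mul_add]
      exact mul_le_mul_of_nonneg_left (hIlip e h hh.le (min_le_left _ _)) (hc e)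
    have h3 : h * (K + 1) ≤ η := (le_div_iff₀ (by positivity)).1 (min_le_right _ _)
    have h4 : 0 ≤ φ T := ENNReal.toReal_nonneg
    have h5 : 0 ≤ V * h * φ T := by positivity
    nlinarith
  have hIe : ∀ e, ENNReal.ofReal (c e) * ((causalExt fun t => P t i (a e)) ⋆ₗ heaviside) T =
      ENNReal.ofReal (c e * I e T) := by
    intro e
    rw [lconvolution_comm, hP.heaviside_lconvolution_toReal i (a e) hT,
      ← ENNReal.ofReal_mul (hc e)]
  have hI0 : ∀ e, 0 ≤ I e T := fun e =>
    intervalIntegral.integral_nonneg hT fun u hu => hP.nonneg u hu.1 _ _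
  change f T + _ ≤ 1
  simp only [hIe]
  rw [← ENNReal.ofReal_sum_of_nonneg fun e _ => mul_nonneg (hc e) (hI0 e),
    ← ENNReal.ofReal_toReal (hft T), ← ENNReal.ofReal_add ENNReal.toReal_nonneg
      (Finset.sum_nonneg fun e _ => mul_nonneg (hc e) (hI0 e))]
  exact ENNReal.ofReal_le_one.2 hfinal

/-- Adding transitions from `a e` to `b e` at rate `c e`, where the process was killed at least at
this rate, gives a process whose transition function is the Dyson series. -/
theorem IsTransitionFunction.dyson [Countable ι]
    (hP : IsTransitionFunction q P) (hq : IsRowFiniteGenerator q S)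
    (hc : ∀ e, 0 ≤ c e) (hkill : ∀ i, ∑ k ∈ S i, q i k + ∑ e, (if i = a e then c e else 0) ≤ 0)
    {b : ε → ι} {S' : ι → Finset ι}
    (hq' : IsRowFiniteGenerator q.transpose S') :
    IsTransitionFunction (q + jumpMatrix a b c) fun t i j =>
      (BirthDeath.dyson (fun i j => causalExt fun t => P t i j) a b (fun e => ENNReal.ofReal (c e))
        i j t).toReal := by
  set d : ι → ι → ℝ → ℝ≥0∞ := fun i j => causalExt fun t => P t i j with hd
  set p := BirthDeath.dyson d a b (fun e => ENNReal.ofReal (c e)) with hp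
  have hdm : ∀ i j, Measurable (d i j) := hP.measurable_causalExt
  have hd0 : ∀ i j, ∀ t < 0, d i j t = 0 := fun i j t => causalExt_of_neg _
  have hck := hP.causalExt_add_time
  have hrow : ∀ i t, ∑' j, p i j t ≤ heaviside t :=
    tsum_dyson_le hdm hd0 fun i t ht => hP.tsum_add_integral_le hq hc hkill i ht
  have hp1 : ∀ i j t, p i j t ≤ 1 := fun i j t =>
    (ENNReal.le_tsum j).trans ((hrow i t).trans (heaviside_le_one t))
  have hpt : ∀ i j t, p i j t ≠ ∞ := fun i j t => ((hp1 i j t).trans_lt ENNReal.one_lt_top).ne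
  have hpm : ∀ i j, Measurable (p i j) := measurable_dyson hdm
  have hp0 : ∀ i j, ∀ t < 0, p i j t = 0 := fun i j t => dyson_of_neg hd0 i j
  have hrowt : ∀ i t, ∑' j, p i j t ≠ ∞ := fun i t =>
    (((hrow i t).trans (heaviside_le_one t)).trans_lt ENNReal.one_lt_top).ne
  refine ⟨?_, fun t _ i j => ENNReal.toReal_nonneg, fun t _ i => ENNReal.summable_toReal (hrowt i t),
    fun t _ i => ?_, fun s hs t ht i j => ?_, fun t ht i j => ?_, fun t ht i j => ?_⟩
  · ext i j
    rw [hp, dyson_zero hd0, hd]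
    simp only [causalExt_of_nonneg _ le_rfl, hP.zero, Matrix.one_apply]
    split_ifs <;> simp
  · rw [← ENNReal.tsum_toReal_eq fun j => hpt i j t]
    exact ENNReal.toReal_le_of_le_ofReal zero_le_one
      (by simpa using (hrow i t).trans (heaviside_le_one t))
  · simp only [hp, dyson_add_time hdm hd0 hck hs ht, ← ENNReal.toReal_mul]
    exact ENNReal.tsum_toReal_eq fun k => ENNReal.mul_ne_top (hpt i k s) (hpt k j t)
  · exact hq.hasDerivWithinAt_backward hc hpm hp0 hp1
      (fun i j => dyson_backward hdm (hP.integrated_backward hq) i j) i j ht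
  -- Forward equation: the transposed series is the Dyson series of the transposed kernel with `a`
  -- and `b` exchanged, and it solves the backward equation for the transposed generator.
  · have hT : ∀ i j, BirthDeath.dyson (fun i j => d j i) b a (fun e => ENNReal.ofReal (c e)) i j =
        p j i := dyson_transpose hdm
    have hback := fun i j => dyson_backward (d := fun i j => d j i) (a := b) (b := a)
      (c := fun e => ENNReal.ofReal (c e)) (fun i j => hdm j i) (hP.integrated_forward hq') i j
    simp only [hT] at hback
    have key := hq'.hasDerivWithinAt_backward (a := b) (b := a) hc (p := fun i j => p j i)
      (fun i j => hpm j i) (fun i j => hp0 j i) (fun i j => hp1 j i) hback j i ht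
    simpa only [Matrix.add_apply, Matrix.transpose_apply, jumpMatrix_transpose b a, mul_comm]
      using key

end Perturbation

/-! ### Gluing the two one-sided processes -/

section Gluing

theorem IsTransitionFunction.submatrix {ι κ : Type*} [DecidableEq ι] [DecidableEq κ]
    {q : Matrix ι ι ℝ} {P : ℝ → Matrix ι ι ℝ} (hP : IsTransitionFunction q P) (e : κ ≃ ι) :
    IsTransitionFunction (q.submatrix e e) fun t => (P t).submatrix e e where
  zero := by simp [hP.zero]
  nonneg t ht i j := hP.nonneg t ht _ _
  summable_row t ht i := e.summable_iff.2 (hP.summable_row t ht (e i))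
  row_le_one t ht i := (e.tsum_eq (P t (e i))).trans_le (hP.row_le_one t ht (e i))
  chapman_kolmogorov s hs t ht i j := (hP.chapman_kolmogorov s hs t ht (e i) (e j)).trans
    (e.tsum_eq fun k => P s (e i) k * P t k (e j)).symm
  backward t ht i j := by
    have h := hP.backward t ht (e i) (e j)
    rwa [← e.tsum_eq] at h
  forward t ht i j := by
    have h := hP.forward t ht (e i) (e j)
    rwa [← e.tsum_eq] at h

theorem tsum_sum_eq_left {ι κ : Type*} {f : ι ⊕ κ → ℝ} (hf : ∀ k, f (Sum.inr k) = 0) :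
    ∑' x, f x = ∑' i, f (Sum.inl i) :=
  (Sum.inl_injective.tsum_eq (by
    rintro (i | k) hx
    · exact ⟨i, rfl⟩
    · exact absurd (hf k) hx)).symm

theorem tsum_sum_eq_right {ι κ : Type*} {f : ι ⊕ κ → ℝ} (hf : ∀ i, f (Sum.inl i) = 0) :
    ∑' x, f x = ∑' k, f (Sum.inr k) :=
  (Sum.inr_injective.tsum_eq (by
    rintro (i | k) hx
    · exact absurd (hf i) hx
    · exact ⟨k, rfl⟩)).symm

/-- The transition function of the disjoint union of two processes. -/
theorem IsTransitionFunction.fromBlocks {ι κ : Type*} [DecidableEq ι] [DecidableEq κ]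
    {q : Matrix ι ι ℝ} {P : ℝ → Matrix ι ι ℝ} {q' : Matrix κ κ ℝ} {P' : ℝ → Matrix κ κ ℝ}
    (hP : IsTransitionFunction q P) (hP' : IsTransitionFunction q' P') :
    IsTransitionFunction (Matrix.fromBlocks q 0 0 q') fun t => Matrix.fromBlocks (P t) 0 0 (P' t) where
  zero := by rw [hP.zero, hP'.zero, Matrix.fromBlocks_one]
  nonneg t ht := by
    rintro (i | i) (j | j)
    exacts [hP.nonneg t ht i j, le_rfl, le_rfl, hP'.nonneg t ht i j]
  summable_row t ht := by
    rintro (i | i)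
    · refine (Sum.inl_injective.summable_iff ?_).1 (hP.summable_row t ht i)
      rintro (k | k) hk
      · exact absurd ⟨k, rfl⟩ hk
      · rfl
    · refine (Sum.inr_injective.summable_iff ?_).1 (hP'.summable_row t ht i)
      rintro (k | k) hk
      · rfl
      · exact absurd ⟨k, rfl⟩ hk
  row_le_one t ht := by
    rintro (i | i)
    · rw [tsum_sum_eq_left fun k => rfl]; exact hP.row_le_one t ht i
    · rw [tsum_sum_eq_right fun k => rfl]; exact hP'.row_le_one t ht i
  chapman_kolmogorov s hs t ht := by
    rintro (i | i) (j | j)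
    · rw [tsum_sum_eq_left fun k => by simp]; exact hP.chapman_kolmogorov s hs t ht i j
    · rw [tsum_sum_eq_left fun k => by simp]; simp
    · rw [tsum_sum_eq_right fun k => by simp]; simp
    · rw [tsum_sum_eq_right fun k => by simp]; exact hP'.chapman_kolmogorov s hs t ht i j
  backward t ht := by
    rintro (i | i) (j | j)
    · rw [tsum_sum_eq_left fun k => by simp]; exact hP.backward t ht i j
    · rw [tsum_sum_eq_left fun k => by simp]; simpa using hasDerivWithinAt_const t (Ici 0) (0 : ℝ)
    · rw [tsum_sum_eq_right fun k => by simp]; simpa using hasDerivWithinAt_const t (Ici 0) (0 : ℝ)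
    · rw [tsum_sum_eq_right fun k => by simp]; exact hP'.backward t ht i j
  forward t ht := by
    rintro (i | i) (j | j)
    · rw [tsum_sum_eq_left fun k => by simp]; exact hP.forward t ht i j
    · rw [tsum_sum_eq_left fun k => by simp]; simpa using hasDerivWithinAt_const t (Ici 0) (0 : ℝ)
    · rw [tsum_sum_eq_right fun k => by simp]; simpa using hasDerivWithinAt_const t (Ici 0) (0 : ℝ)
    · rw [tsum_sum_eq_right fun k => by simp]; exact hP'.forward t ht i j

/-- The matrix on `ℤ` with diagonal blocks `A` (on `0, 1, …`) and `B` (on `-1, -2, …`). -/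
def glue (A B : Matrix ℕ ℕ ℝ) : Matrix ℤ ℤ ℝ :=
  (Matrix.fromBlocks A 0 0 B).submatrix Equiv.intEquivNatSumNat Equiv.intEquivNatSumNat

theorem glue_apply_zero_neg_one (A B : Matrix ℕ ℕ ℝ) : glue A B 0 (-1) = 0 := rfl

theorem glue_apply_neg_one_zero (A B : Matrix ℕ ℕ ℝ) : glue A B (-1) 0 = 0 := rfl

variable {lam mu : ℤ → ℝ}

variable (lam mu) in
/-- The generator of the disjoint union of the two one-sided processes. -/
def gluedGenerator : Matrix ℤ ℤ ℝ :=
  glue (halfLineGenerator (birthPos lam) (deathPos mu)) (halfLineGenerator (birthNeg mu) (deathNeg lam))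

theorem gluedGenerator_apply (i j : ℤ) : gluedGenerator lam mu i j =
    if (0 ≤ i ↔ 0 ≤ j) then bilateralGenerator lam mu i j else 0 := by
  rcases i with i | i <;> rcases j with j | j
  · rw [if_pos (by simp)]
    exact (congrFun (congrFun (submatrix_pos lam mu) i) j).symm
  · rw [if_neg (by simp)]
    rfl
  · rw [if_neg (by simp)]
    rfl
  · rw [if_pos (by simp)]
    have h := (congrFun (congrFun (submatrix_neg lam mu) i) j).symm
    rw [Matrix.submatrix_apply] at h
    rw [show Int.negSucc i = -1 - (i : ℤ) by omega, show Int.negSucc j = -1 - (j : ℤ) by omega, ← h,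
      show -1 - (i : ℤ) = Int.negSucc i by omega, show -1 - (j : ℤ) = Int.negSucc j by omega]
    rfl

/-- Cutting ℤ between -1 and 0 deletes just two off-diagonal entries and keeps the full exit rates
on the diagonal. The index `true` stands for the crossing -1 → 0, `false` for 0 → -1. -/
theorem gluedGenerator_add_jumpMatrix :
    gluedGenerator lam mu + jumpMatrix (fun e : Bool => if e then (-1 : ℤ) else 0)
      (fun e => if e then 0 else -1) (fun e => if e then lam (-1) else mu 0) =
    bilateralGenerator lam mu := by
  ext i j
  simp only [Matrix.add_apply, gluedGenerator_apply, jumpMatrix, Fintype.sum_bool,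
    bilateralGenerator]
  by_cases h1 : i = -1 ∧ j = 0
  · obtain ⟨rfl, rfl⟩ := h1
    simp
  by_cases h2 : i = 0 ∧ j = -1
  · obtain ⟨rfl, rfl⟩ := h2
    simp
  simp only [if_true, Bool.false_eq_true, if_false, h1, h2, add_zero]
  split_ifs <;> first | rfl | omega

theorem isRowFiniteGenerator_gluedGenerator (hlam : ∀ n, 0 < lam n) (hmu : ∀ n, 0 < mu n) :
    IsRowFiniteGenerator (gluedGenerator lam mu) fun i => {i - 1, i, i + 1} where
  eq_zero i k hk := by
    simp only [Finset.mem_insert, Finset.mem_singleton, not_or] at hk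
    rw [gluedGenerator_apply, bilateralGenerator]
    split_ifs <;> first | rfl | omega
  off_diag i k hk := by
    rw [gluedGenerator_apply, bilateralGenerator]
    have := hlam i
    have := hmu i
    split_ifs <;> positivity
  diag i := by
    rw [gluedGenerator_apply, bilateralGenerator]
    have := hlam i
    have := hmu i
    simp only [if_true, left_eq_add, one_ne_zero, if_false]
    linarith

theorem isRowFiniteGenerator_gluedGenerator_transpose (hlam : ∀ n, 0 < lam n)
    (hmu : ∀ n, 0 < mu n) :
    IsRowFiniteGenerator (gluedGenerator lam mu).transpose fun i => {i - 1, i, i + 1} where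
  eq_zero i k hk := by
    simp only [Finset.mem_insert, Finset.mem_singleton, not_or] at hk
    exact (isRowFiniteGenerator_gluedGenerator hlam hmu).eq_zero k i (by
      simp only [Finset.mem_insert, Finset.mem_singleton, not_or]; omega)
  off_diag i k hk := (isRowFiniteGenerator_gluedGenerator hlam hmu).off_diag k i hk.symm
  diag i := (isRowFiniteGenerator_gluedGenerator hlam hmu).diag i

/-- The bilateral rows sum to zero, so the glued process is killed at 0 and at -1 exactly at the
rate of the deleted crossing, and nowhere else. This is the room needed to add the crossings back.
-/
theorem sum_gluedGenerator_add (lam mu : ℤ → ℝ) (i : ℤ) :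
    ∑ k ∈ ({i - 1, i, i + 1} : Finset ℤ), gluedGenerator lam mu i k +
      ∑ e : Bool, (if i = (if e then (-1 : ℤ) else 0) then (if e then lam (-1) else mu 0) else 0) ≤
        0 := by
  have h1 : i - 1 ∉ ({i, i + 1} : Finset ℤ) := by
    simp only [Finset.mem_insert, Finset.mem_singleton, not_or]; omega
  have h2 : i ∉ ({i + 1} : Finset ℤ) := by simp
  rw [Finset.sum_insert h1, Finset.sum_insert h2, Finset.sum_singleton, Fintype.sum_bool]
  simp only [gluedGenerator_apply, bilateralGenerator, if_true, Bool.false_eq_true, if_false]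
  by_cases hi : i = -1
  · subst hi; norm_num
  by_cases hi' : i = 0
  · subst hi'; norm_num
  rw [if_pos (show (0 ≤ i ↔ 0 ≤ i - 1) by omega), if_neg (show ¬ (i - 1 = i + 1) by omega),
    if_neg (show ¬ (i - 1 = i) by omega), if_pos (show i - 1 + 1 = i by omega),
    if_neg (show ¬ (i = i + 1) by omega), if_pos (show (0 ≤ i ↔ 0 ≤ i + 1) by omega),
    if_neg hi, if_neg hi']
  linarith

/-- The renewal equations which express the transition function of the bilateral process between
the states `0` and `-1` through those of the one-sided processes. -/
theorem renewal_equations (hlam : ∀ n, 0 < lam n) (hmu : ∀ n, 0 < mu n)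
    (hunique : UniquelyDetermines (bilateralGenerator lam mu)) {P : ℝ → Matrix ℤ ℤ ℝ}
    (hP : IsTransitionFunction (bilateralGenerator lam mu) P) {Pp Pm : ℝ → Matrix ℕ ℕ ℝ}
    (hPp : IsTransitionFunction (halfLineGenerator (birthPos lam) (deathPos mu)) Pp)
    (hPm : IsTransitionFunction (halfLineGenerator (birthNeg mu) (deathNeg lam)) Pm) :
    let p : ℤ → ℤ → ℝ → ℝ≥0∞ := fun i j => causalExt fun t => P t i j
    let u : ℝ → ℝ≥0∞ := causalExt fun t => Pp t 0 0
    let v : ℝ → ℝ≥0∞ := causalExt fun t => Pm t 0 0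
    p 0 0 = u + ENNReal.ofReal (mu 0) • (u ⋆ₗ p (-1) 0) ∧
    p (-1) 0 = ENNReal.ofReal (lam (-1)) • (v ⋆ₗ p 0 0) ∧
    p (-1) (-1) = v + ENNReal.ofReal (lam (-1)) • (v ⋆ₗ p 0 (-1)) ∧
    p 0 (-1) = ENNReal.ofReal (mu 0) • (u ⋆ₗ p (-1) (-1)) := by
  intro p u v
  have hD : IsTransitionFunction (gluedGenerator lam mu) fun t => glue (Pp t) (Pm t) :=
    (hPp.fromBlocks hPm).submatrix _
  have hdyson := hD.dyson (isRowFiniteGenerator_gluedGenerator hlam hmu)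
    (fun e => by cases e; exacts [(hmu 0).le, (hlam (-1)).le]) (sum_gluedGenerator_add lam mu)
    (b := fun e => if e then 0 else -1)
    (isRowFiniteGenerator_gluedGenerator_transpose hlam hmu)
  rw [gluedGenerator_add_jumpMatrix] at hdyson
  set d : ℤ → ℤ → ℝ → ℝ≥0∞ := fun i j => causalExt fun t => glue (Pp t) (Pm t) i j with hd
  have hdm : ∀ i j, Measurable (d i j) := hD.measurable_causalExt
  have hd0 : ∀ i j, ∀ t < 0, d i j t = 0 := fun i j t => causalExt_of_neg _
  have hrow := tsum_dyson_le (b := fun e : Bool => if e then (0 : ℤ) else -1) hdm hd0 fun i t ht => hD.tsum_add_integral_le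
    (isRowFiniteGenerator_gluedGenerator hlam hmu)
    (fun e => by cases e; exacts [(hmu 0).le, (hlam (-1)).le]) (sum_gluedGenerator_add lam mu)
    i ht
  -- Uniqueness of the bilateral process identifies P with the Dyson series; the row-sum bound makes
  -- the series finite, so passing through `toReal` loses nothing.
  have hp : ∀ i j, p i j = dyson d (fun e : Bool => if e then (-1 : ℤ) else 0)
      (fun e => if e then 0 else -1)
      (fun e => ENNReal.ofReal (if e then lam (-1) else mu 0)) i j := by
    intro i j
    ext t
    rcases lt_or_ge t 0 with ht | ht
    · rw [dyson_of_neg hd0 i j ht]; exact causalExt_of_neg _ ht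
    · have h := congrFun (congrFun (hunique _ _ hP hdyson t ht) i) j
      simp only [p, causalExt_of_nonneg _ ht, h]
      refine ENNReal.ofReal_toReal (ne_top_of_le_ne_top ENNReal.one_ne_top ?_)
      exact (ENNReal.le_tsum j).trans ((hrow i t).trans (heaviside_le_one t))
  have key : ∀ i j, p i j = d i j + (ENNReal.ofReal (lam (-1)) • (d i (-1) ⋆ₗ p 0 j) +
      ENNReal.ofReal (mu 0) • (d i 0 ⋆ₗ p (-1) j)) := by
    intro i j
    rw [hp, dyson_eq hdm, Fintype.sum_bool]
    simp only [← hp, if_true, Bool.false_eq_true, if_false]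
  have d00 : d 0 0 = u := rfl
  have d11 : d (-1) (-1) = v := rfl
  -- The glued process never crosses, so from each starting state only one of the two channels
  -- contributes.
  have d01 : d 0 (-1) = 0 := by
    ext t
    simp only [hd, glue_apply_zero_neg_one]
    simp [causalExt]
  have d10 : d (-1) 0 = 0 := by
    ext t
    simp only [hd, glue_apply_neg_one_zero]
    simp [causalExt]
  refine ⟨?_, ?_, ?_, ?_⟩
  · rw [key 0 0, d01, d00, zero_lconvolution, smul_zero, zero_add]
  · rw [key (-1) 0, d10, d11, zero_lconvolution, smul_zero, zero_add, add_zero]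
  · rw [key (-1) (-1), d10, d11, zero_lconvolution, smul_zero, add_zero]
  · rw [key 0 (-1), d01, d00, zero_lconvolution, smul_zero, zero_add, zero_add]

end Gluing

/-! ### Laplace transforms -/

section Laplace

/-- The Laplace transform at the real point `s`. -/
noncomputable def laplace (s : ℝ) (f : ℝ → ℝ≥0∞) : ℝ≥0∞ :=
  ∫⁻ t, ENNReal.ofReal (Real.exp (-s * t)) * f t

theorem laplace_add {s : ℝ} {f g : ℝ → ℝ≥0∞} (hf : Measurable f) :
    laplace s (f + g) = laplace s f + laplace s g := by
  simp only [laplace, Pi.add_apply, mul_add]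
  exact lintegral_add_left (by fun_prop) _

theorem laplace_smul {s : ℝ} {f : ℝ → ℝ≥0∞} (hf : Measurable f) (c : ℝ≥0∞) :
    laplace s (c • f) = c * laplace s f := by
  simp only [laplace, Pi.smul_apply, smul_eq_mul]
  rw [← lintegral_const_mul _ (by fun_prop)]
  simp only [mul_left_comm]

/-- Tonelli and translation invariance; with values in [0, ∞] no condition on convergence or on `s`
is needed. -/
theorem laplace_lconvolution {s : ℝ} {f g : ℝ → ℝ≥0∞} (hf : Measurable f) (hg : Measurable g) :
    laplace s (f ⋆ₗ g) = laplace s f * laplace s g := by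
  have h1 : ∀ x y : ℝ, ENNReal.ofReal (Real.exp (-s * x)) * (f y * g (-y + x)) =
      (ENNReal.ofReal (Real.exp (-s * y)) * f y) *
        (ENNReal.ofReal (Real.exp (-s * (-y + x))) * g (-y + x)) := by
    intro x y
    have : Real.exp (-s * x) = Real.exp (-s * y) * Real.exp (-s * (-y + x)) := by
      rw [← Real.exp_add]; congr 1; ring
    rw [this, ENNReal.ofReal_mul (Real.exp_pos _).le]
    ring
  calc laplace s (f ⋆ₗ g)
      = ∫⁻ x, ∫⁻ y, ENNReal.ofReal (Real.exp (-s * x)) * (f y * g (-y + x)) := by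
        simp only [laplace, lconvolution_def]
        refine lintegral_congr fun x => ?_
        rw [lintegral_const_mul _ (by fun_prop)]
    _ = ∫⁻ y, ∫⁻ x, (ENNReal.ofReal (Real.exp (-s * y)) * f y) *
        (ENNReal.ofReal (Real.exp (-s * (-y + x))) * g (-y + x)) := by
        simp only [h1]
        rw [lintegral_lintegral_swap (by fun_prop)]
    _ = ∫⁻ y, (ENNReal.ofReal (Real.exp (-s * y)) * f y) * laplace s g := by
        refine lintegral_congr fun y => ?_
        rw [lintegral_const_mul _ (by fun_prop), lintegral_add_left_eq_self
          (fun x => ENNReal.ofReal (Real.exp (-s * x)) * g x)]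
        rfl
    _ = laplace s f * laplace s g := lintegral_mul_const _ (by fun_prop)

theorem lintegral_exp_neg_mul_Ici {r : ℝ} (hr : 0 < r) :
    ∫⁻ t in Ici 0, ENNReal.ofReal (Real.exp (-r * t)) = ENNReal.ofReal r⁻¹ := by
  rw [← setLIntegral_congr Ioi_ae_eq_Ici, ← ofReal_integral_eq_lintegral_ofReal
    (integrableOn_exp_mul_Ioi (neg_lt_zero.2 hr) 0) (ae_of_all _ fun t => (Real.exp_pos _).le),
    integral_exp_mul_Ioi (neg_lt_zero.2 hr)]
  congr 1
  simp

theorem laplace_causalExt (s : ℝ) (f : ℝ → ℝ) : laplace s (causalExt f) =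
    ∫⁻ t in Ici 0, ENNReal.ofReal (Real.exp (-s * t)) * ENNReal.ofReal (f t) := by
  rw [laplace, ← lintegral_indicator measurableSet_Ici]
  congr 1
  ext t
  rcases lt_or_ge t 0 with ht | ht
  · rw [causalExt_of_neg _ ht, indicator_of_notMem (by simpa using ht), mul_zero]
  · rw [causalExt_of_nonneg _ ht, indicator_of_mem (mem_Ici.2 ht)]

theorem integrableOn_exp_neg_mul (ν : Measure ℝ) [IsFiniteMeasure ν] {t : ℝ} (ht : 0 ≤ t) :
    IntegrableOn (fun x => Real.exp (-x * t)) (Ici 0) ν := by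
  refine Integrable.of_bound (by fun_prop) 1 ?_
  filter_upwards [ae_restrict_mem measurableSet_Ici] with x hx
  rw [Real.norm_of_nonneg (Real.exp_pos _).le, Real.exp_le_one_iff]
  have : 0 ≤ x * t := mul_nonneg hx ht
  linarith

theorem integrableOn_inv_add (ν : Measure ℝ) [IsFiniteMeasure ν] {s : ℝ} (hs : 0 < s) :
    IntegrableOn (fun x => (x + s)⁻¹) (Ici 0) ν := by
  refine Integrable.of_bound (by fun_prop) s⁻¹ ?_
  filter_upwards [ae_restrict_mem measurableSet_Ici] with x hx
  have hx : 0 ≤ x := hx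
  rw [Real.norm_of_nonneg (by positivity)]
  gcongr
  linarith

/-- The Laplace transform of `t ↦ ∫ exp (-x t) dν(x)` is the Stieltjes transform of `ν`. -/
theorem laplace_integral_exp (ν : Measure ℝ) [IsFiniteMeasure ν] {s : ℝ} (hs : 0 < s) :
    laplace s (causalExt fun t => ∫ x in Ici 0, Real.exp (-x * t) ∂ν) =
      ENNReal.ofReal (∫ x in Ici 0, (x + s)⁻¹ ∂ν) := by
  have h1 : ∀ t ∈ Ici (0 : ℝ), ENNReal.ofReal (Real.exp (-s * t)) *
      ENNReal.ofReal (∫ x in Ici 0, Real.exp (-x * t) ∂ν) =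
      ∫⁻ x in Ici 0, ENNReal.ofReal (Real.exp (-(x + s) * t)) ∂ν := by
    intro t ht
    rw [ofReal_integral_eq_lintegral_ofReal (integrableOn_exp_neg_mul ν ht)
      (ae_of_all _ fun x => (Real.exp_pos _).le), ← lintegral_const_mul _ (by fun_prop)]
    refine lintegral_congr fun x => ?_
    rw [← ENNReal.ofReal_mul (Real.exp_pos _).le, ← Real.exp_add]
    congr 2
    ring
  rw [laplace_causalExt, setLIntegral_congr_fun measurableSet_Ici h1,
    lintegral_lintegral_swap (by fun_prop), ofReal_integral_eq_lintegral_ofReal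
      (integrableOn_inv_add ν hs)]
  · refine setLIntegral_congr_fun measurableSet_Ici fun x hx => ?_
    have hx : 0 ≤ x := hx
    exact lintegral_exp_neg_mul_Ici (by linarith)
  · filter_upwards [ae_restrict_mem measurableSet_Ici] with x hx
    have hx : 0 ≤ x := hx
    exact inv_nonneg.2 (by linarith)

theorem laplace_lt_top {s : ℝ} (hs : 0 < s) {f : ℝ → ℝ≥0∞} (hf : ∀ t, f t ≤ heaviside t) :
    laplace s f < ∞ := by
  calc laplace s f ≤ ∫⁻ t in Ici 0, ENNReal.ofReal (Real.exp (-s * t)) := by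
        rw [laplace, ← lintegral_indicator measurableSet_Ici]
        refine lintegral_mono fun t => ?_
        rcases lt_or_ge t 0 with ht | ht
        · have := hf t
          rw [heaviside_of_neg ht, nonpos_iff_eq_zero] at this
          simp [this]
        · rw [indicator_of_mem (mem_Ici.2 ht)]
          exact mul_le_of_le_one_right' ((hf t).trans (heaviside_le_one t))
    _ < ∞ := by rw [lintegral_exp_neg_mul_Ici hs]; exact ENNReal.ofReal_lt_top

theorem stieltjes_neg_ofReal (ν : Measure ℝ) {s : ℝ} :
    stieltjes (-(s : ℂ)) ν = ((∫ x in Ici 0, (x + s)⁻¹ ∂ν : ℝ) : ℂ) := by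
  rw [stieltjes, ← integral_complex_ofReal]
  congr 1
  ext x
  push_cast
  rw [sub_neg_eq_add]

theorem stieltjes_eq_laplace {ν : Measure ℝ} [IsFiniteMeasure ν] {f : ℝ → ℝ}
    (hf : ∀ t, 0 ≤ t → f t = ∫ x in Ici 0, Real.exp (-x * t) ∂ν) {s : ℝ} (hs : 0 < s) :
    stieltjes (-(s : ℂ)) ν = ((laplace s (causalExt f)).toReal : ℂ) := by
  have h : causalExt f = causalExt fun t => ∫ x in Ici 0, Real.exp (-x * t) ∂ν := by
    ext t
    rcases lt_or_ge t 0 with ht | ht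
    · rw [causalExt_of_neg _ ht, causalExt_of_neg _ ht]
    · rw [causalExt_of_nonneg _ ht, causalExt_of_nonneg _ ht, hf t ht]
  rw [h, laplace_integral_exp ν hs, stieltjes_neg_ofReal, ENNReal.toReal_ofReal]
  refine setIntegral_nonneg measurableSet_Ici fun x hx => ?_
  have hx : 0 ≤ x := hx
  exact inv_nonneg.2 (by linarith)

end Laplace

/-! ### Stieltjes transforms of measures and signed measures -/

section Stieltjes

/-- The Jordan decomposition reduces integrals against a signed measure to two finite positive
measures, to which the Laplace and holomorphy results apply. -/
theorem setIntegral_signedMeasure_eq_sub {E : Type*} [NormedAddCommGroup E] [NormedSpace ℝ E]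
    (ψ : SignedMeasure ℝ) {f : ℝ → E} {s : Set ℝ} (hs : MeasurableSet s)
    (hp : IntegrableOn f s ψ.toJordanDecomposition.posPart)
    (hn : IntegrableOn f s ψ.toJordanDecomposition.negPart) :
    ∫ᵛ x in s, f x ∂<•ψ = (∫ x in s, f x ∂ψ.toJordanDecomposition.posPart) -
      ∫ x in s, f x ∂ψ.toJordanDecomposition.negPart := by
  have h : ψ.restrict s = ψ.toJordanDecomposition.posPart.toSignedMeasure.restrict s -
      ψ.toJordanDecomposition.negPart.toSignedMeasure.restrict s := by
    conv_lhs => rw [← ψ.toSignedMeasure_toJordanDecomposition, JordanDecomposition.toSignedMeasure]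
    ext t ht
    simp [VectorMeasure.restrict_apply _ hs ht]
  rw [h, VectorMeasure.integral_sub_vectorMeasure]
  · rw [VectorMeasure.setIntegral_toSignedMeasure hs, VectorMeasure.setIntegral_toSignedMeasure hs]
  · rw [VectorMeasure.Integrable, VectorMeasure.variation_restrict hs,
      Measure.variation_toSignedMeasure]
    exact hp
  · rw [VectorMeasure.Integrable, VectorMeasure.variation_restrict hs,
      Measure.variation_toSignedMeasure]
    exact hn

/-- A ball of radius r about `w` inside the slit plane contains no point -x with x ≥ 0, so points
within r/2 of `w` stay at distance at least r/2 from all of them. This yields the uniform bounds for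
the Stieltjes kernel and its derivative. -/
theorem exists_forall_le_norm_add {w : ℂ} (hw : w ∈ Complex.slitPlane) :
    ∃ δ > 0, ∀ w' ∈ Metric.ball w δ, ∀ x : ℝ, 0 ≤ x → δ ≤ ‖(x : ℂ) + w'‖ := by
  obtain ⟨r, hr, hball⟩ := Metric.isOpen_iff.1 Complex.isOpen_slitPlane w hw
  refine ⟨r / 2, by positivity, fun w' hw' x hx => ?_⟩
  by_contra! h
  have hmem : -(x : ℂ) ∈ Metric.ball w r := by
    rw [Metric.mem_ball] at hw' ⊢
    have h1 : dist (-(x : ℂ)) w' < r / 2 := by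
      rwa [dist_eq_norm, show -(x : ℂ) - w' = -((x : ℂ) + w') by ring, norm_neg]
    linarith [dist_triangle (-(x : ℂ)) w' w]
  have := hball hmem
  rw [Complex.mem_slitPlane_iff] at this
  simp at this
  linarith

theorem integrableOn_inv_sub (ν : Measure ℝ) [IsFiniteMeasure ν] {w : ℂ}
    (hw : w ∈ Complex.slitPlane) :
    IntegrableOn (fun x : ℝ => ((x : ℂ) - -w)⁻¹) (Ici 0) ν := by
  obtain ⟨δ, hδ, h⟩ := exists_forall_le_norm_add hw
  refine Integrable.of_bound (by fun_prop) δ⁻¹ ?_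
  filter_upwards [ae_restrict_mem measurableSet_Ici] with x hx
  rw [norm_inv, sub_neg_eq_add]
  gcongr
  exact h w (Metric.mem_ball_self hδ) x hx

theorem signedStieltjes_eq_sub (ψ : SignedMeasure ℝ) {w : ℂ} (hw : w ∈ Complex.slitPlane) :
    signedStieltjes (-w) ψ = stieltjes (-w) ψ.toJordanDecomposition.posPart -
      stieltjes (-w) ψ.toJordanDecomposition.negPart :=
  setIntegral_signedMeasure_eq_sub ψ measurableSet_Ici (integrableOn_inv_sub _ hw)
    (integrableOn_inv_sub _ hw)

/-- The variable w = -z turns ℂ ∖ [0, ∞) into the slit plane. Differentiation under the integral is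
dominated locally by the constant 1/δ², integrable because the measure is finite. -/
theorem differentiableOn_stieltjes (ν : Measure ℝ) [IsFiniteMeasure ν] :
    DifferentiableOn ℂ (fun w => stieltjes (-w) ν) Complex.slitPlane := by
  intro w hw
  obtain ⟨δ, hδ, h⟩ := exists_forall_le_norm_add hw
  have key := hasDerivAt_integral_of_dominated_loc_of_deriv_le (μ := ν.restrict (Ici 0))
    (F := fun w (x : ℝ) => ((x : ℂ) - -w)⁻¹) (F' := fun w (x : ℝ) => -1 / ((x : ℂ) - -w) ^ 2)
    (bound := fun _ => 1 / δ ^ 2) (Metric.ball_mem_nhds w hδ)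
    (Filter.Eventually.of_forall fun w' => by fun_prop) (integrableOn_inv_sub ν hw)
    (Measurable.aestronglyMeasurable (by fun_prop)) ?_ (integrable_const _) ?_
  · exact key.2.differentiableAt.differentiableWithinAt
  · filter_upwards [ae_restrict_mem measurableSet_Ici] with x hx w' hw'
    rw [norm_div, norm_neg, norm_one, norm_pow, sub_neg_eq_add]
    gcongr
    exact h w' hw' x hx
  · filter_upwards [ae_restrict_mem measurableSet_Ici] with x hx w' hw'
    have hne : (x : ℂ) - -w' ≠ 0 := by
      rw [sub_neg_eq_add, ← norm_pos_iff]
      exact hδ.trans_le (h w' hw' x hx)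
    have hd : HasDerivAt (fun w => (x : ℂ) - -w) 1 w' := by
      simpa using (hasDerivAt_id w').neg.const_sub (x : ℂ)
    exact hd.inv hne

theorem differentiableOn_signedStieltjes (ψ : SignedMeasure ℝ) :
    DifferentiableOn ℂ (fun w => signedStieltjes (-w) ψ) Complex.slitPlane :=
  ((differentiableOn_stieltjes _).sub (differentiableOn_stieltjes _)).congr
    fun _ hw => signedStieltjes_eq_sub ψ hw

/-- Adding the Laplace integral of the negative part to `f` gives that of the positive part, an
identity between nonnegative functions that can be transformed term by term. All transforms are
finite, so the negative part can be subtracted again afterwards. -/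
theorem signedStieltjes_eq_laplace {ψ : SignedMeasure ℝ} {f : ℝ → ℝ} (hf0 : ∀ t, 0 ≤ t → 0 ≤ f t)
    (hfH : ∀ t, causalExt f t ≤ heaviside t) (hfm : Measurable (causalExt f))
    (hf : ∀ t, 0 ≤ t → f t = ∫ᵛ x in Ici 0, Real.exp (-x * t) ∂<•ψ) {s : ℝ} (hs : 0 < s) :
    signedStieltjes (-(s : ℂ)) ψ = ((laplace s (causalExt f)).toReal : ℂ) := by
  set νp := ψ.toJordanDecomposition.posPart with hνp
  set νn := ψ.toJordanDecomposition.negPart with hνn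
  have hsum : causalExt f + causalExt (fun t => ∫ x in Ici 0, Real.exp (-x * t) ∂νn) =
      causalExt fun t => ∫ x in Ici 0, Real.exp (-x * t) ∂νp := by
    ext t
    rw [Pi.add_apply]
    rcases lt_or_ge t 0 with ht | ht
    · simp [causalExt_of_neg _ ht]
    · simp only [causalExt_of_nonneg _ ht]
      rw [← ENNReal.ofReal_add (hf0 t ht)
        (integral_nonneg fun x => (Real.exp_pos _).le), hf t ht,
        setIntegral_signedMeasure_eq_sub ψ measurableSet_Ici (integrableOn_exp_neg_mul _ ht)
          (integrableOn_exp_neg_mul _ ht), sub_add_cancel]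
  have hL := congrArg (laplace s) hsum
  rw [laplace_add hfm, laplace_integral_exp _ hs, laplace_integral_exp _ hs] at hL
  have hnn : ∀ ν : Measure ℝ, 0 ≤ ∫ x in Ici 0, (x + s)⁻¹ ∂ν := fun ν =>
    setIntegral_nonneg measurableSet_Ici fun x hx => by
      have hx : 0 ≤ x := hx
      exact inv_nonneg.2 (by linarith)
  have hR := congrArg ENNReal.toReal hL
  rw [ENNReal.toReal_add (laplace_lt_top hs hfH).ne ENNReal.ofReal_ne_top,
    ENNReal.toReal_ofReal (hnn _), ENNReal.toReal_ofReal (hnn _)] at hR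
  rw [signedStieltjes_eq_sub ψ (by simpa using hs), stieltjes_neg_ofReal,
    stieltjes_neg_ofReal, ← hνp, ← hνn, ← hR]
  push_cast
  ring

/-- Holomorphic functions on the slit plane which agree on the positive half-line are equal. -/
theorem eqOn_slitPlane_of_eq_on_pos {F G : ℂ → ℂ} (hF : DifferentiableOn ℂ F Complex.slitPlane)
    (hG : DifferentiableOn ℂ G Complex.slitPlane) (h : ∀ s : ℝ, 0 < s → F s = G s) :
    EqOn F G Complex.slitPlane := by
  have hpre : IsPreconnected Complex.slitPlane :=
    (Complex.starConvex_one_slitPlane.isPathConnected Complex.one_mem_slitPlane).isConnected.isPreconnected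
  refine (hF.analyticOnNhd Complex.isOpen_slitPlane).eqOn_of_preconnected_of_frequently_eq
    (hG.analyticOnNhd Complex.isOpen_slitPlane) hpre Complex.one_mem_slitPlane ?_
  have ht : Filter.Tendsto (fun s : ℝ => (s : ℂ)) (𝓝[≠] 1) (𝓝[≠] 1) := by
    refine tendsto_nhdsWithin_iff.2 ⟨?_, ?_⟩
    · exact (Complex.continuous_ofReal.tendsto' 1 1 (by simp)).mono_left nhdsWithin_le_nhds
    · filter_upwards [self_mem_nhdsWithin] with s hs
      simpa using hs
  refine ht.frequently (Filter.Eventually.frequently ?_)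
  exact nhdsWithin_le_nhds (Filter.mem_of_superset (Ioi_mem_nhds one_pos) fun s hs => h s hs)

end Stieltjes

/-! ### The Karlin-McGregor formula near the origin and the main relations -/

section Main

theorem IsTransitionFunction.causalExt_le_heaviside {ι : Type*} [DecidableEq ι] {q : Matrix ι ι ℝ}
    {P : ℝ → Matrix ι ι ℝ} (hP : IsTransitionFunction q P) (i j : ι) (t : ℝ) :
    causalExt (fun t => P t i j) t ≤ heaviside t :=
  (ENNReal.le_tsum j).trans (hP.tsum_causalExt_le i t)

theorem IsSpectralMeasure.apply_zero_zero {l m : ℕ → ℝ} {P : ℝ → Matrix ℕ ℕ ℝ} {ψ : Measure ℝ}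
    (hψ : IsSpectralMeasure l m P ψ) {t : ℝ} (ht : 0 ≤ t) :
    P t 0 0 = ∫ x in Ici 0, Real.exp (-x * t) ∂ψ := by
  simpa [halfLinePotential, halfLinePoly, recSol] using hψ.karlin_mcgregor t ht 0 0

variable {lam mu : ℤ → ℝ}

theorem bilateralPoly_zero_zero (x : ℝ) : bilateralPoly lam mu 0 0 x = 1 := rfl

theorem bilateralPoly_one_zero (x : ℝ) : bilateralPoly lam mu 1 0 x = 0 := rfl

theorem bilateralPoly_zero_neg_one (x : ℝ) : bilateralPoly lam mu 0 (-1) x = 0 := rfl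

theorem bilateralPoly_one_neg_one (x : ℝ) : bilateralPoly lam mu 1 (-1) x = 1 := rfl

theorem bilateralPotential_zero : bilateralPotential lam mu 0 = 1 := rfl

theorem bilateralPotential_neg_one : bilateralPotential lam mu (-1) = mu 0 / lam (-1) := by
  change ∏ k ∈ Finset.range 1, mu (-k) / lam (-(k + 1)) = _
  simp

variable {P : ℝ → Matrix ℤ ℤ ℝ} {Ψ : Matrix (Fin 2) (Fin 2) (SignedMeasure ℝ)}

/-- At the states 0 and -1 each Q^α is the constant 0 or 1, so the double sum collapses to one entry
of Ψ. In the next two lemmas the prefactor is π_{-1} = μ_0/λ_{-1}. -/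
theorem IsSpectralMatrix.apply_zero_zero (hΨ : IsSpectralMatrix lam mu P Ψ) {t : ℝ} (ht : 0 ≤ t) :
    P t 0 0 = ∫ᵛ x in Ici 0, Real.exp (-x * t) ∂<•(Ψ 0 0) := by
  have h := hΨ.karlin_mcgregor t ht 0 0
  simpa [Fin.sum_univ_two, bilateralPoly_zero_zero, bilateralPoly_one_zero,
    bilateralPotential_zero] using h

theorem IsSpectralMatrix.apply_neg_one_neg_one (hΨ : IsSpectralMatrix lam mu P Ψ) {t : ℝ}
    (ht : 0 ≤ t) : P t (-1) (-1) =
      mu 0 / lam (-1) * ∫ᵛ x in Ici 0, Real.exp (-x * t) ∂<•(Ψ 1 1) := by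
  have h := hΨ.karlin_mcgregor t ht (-1) (-1)
  simpa [Fin.sum_univ_two, bilateralPoly_zero_neg_one, bilateralPoly_one_neg_one,
    bilateralPotential_neg_one] using h

theorem IsSpectralMatrix.apply_zero_neg_one (hΨ : IsSpectralMatrix lam mu P Ψ) {t : ℝ}
    (ht : 0 ≤ t) : P t 0 (-1) =
      mu 0 / lam (-1) * ∫ᵛ x in Ici 0, Real.exp (-x * t) ∂<•(Ψ 0 1) := by
  have h := hΨ.karlin_mcgregor t ht 0 (-1)
  simpa [Fin.sum_univ_two, bilateralPoly_zero_neg_one, bilateralPoly_one_neg_one,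
    bilateralPoly_zero_zero, bilateralPoly_one_zero, bilateralPotential_neg_one] using h

/-- The potential coefficient is absorbed into the signed measure `κ • ψ`, so that the represented
function is P_ij itself. -/
theorem signedStieltjes_smul_eq_laplace {q : Matrix ℤ ℤ ℝ} (hP : IsTransitionFunction q P)
    (i j : ℤ) {κ : ℝ} {ψ : SignedMeasure ℝ}
    (h : ∀ t, 0 ≤ t → P t i j = κ * ∫ᵛ x in Ici 0, Real.exp (-x * t) ∂<•ψ) {s : ℝ} (hs : 0 < s) :
    (κ : ℂ) * signedStieltjes (-(s : ℂ)) ψ =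
      ((laplace s (causalExt fun t => P t i j)).toReal : ℂ) := by
  rw [← signedStieltjes_eq_laplace (ψ := κ • ψ) (fun t ht => hP.nonneg t ht i j)
    (hP.causalExt_le_heaviside i j) (hP.measurable_causalExt i j) (fun t ht => ?_) hs]
  · rw [signedStieltjes, signedStieltjes, VectorMeasure.restrict_smul,
      VectorMeasure.integral_smul_vectorMeasure, Complex.real_smul]
  · rw [h t ht, VectorMeasure.restrict_smul, VectorMeasure.integral_smul_vectorMeasure, smul_eq_mul]

end Main

end BirthDeath

/-- Stieltjes transform relations between the spectral matrix of a bilateral birth-death process and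
the spectral measures `ψp`, `ψm` of the two one-sided processes. -/
theorem mainTheorem1
    (lam mu : ℤ → ℝ) (hlam : ∀ n, 0 < lam n) (hmu : ∀ n, 0 < mu n)
    (hunique : BirthDeath.UniquelyDetermines (BirthDeath.bilateralGenerator lam mu))
    (P : ℝ → Matrix ℤ ℤ ℝ)
    (hP : BirthDeath.IsTransitionFunction (BirthDeath.bilateralGenerator lam mu) P)
    (Pp Pm : ℝ → Matrix ℕ ℕ ℝ)
    (hPp : BirthDeath.IsTransitionFunction
      (BirthDeath.halfLineGenerator (BirthDeath.birthPos lam) (BirthDeath.deathPos mu)) Pp)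
    (hPm : BirthDeath.IsTransitionFunction
      (BirthDeath.halfLineGenerator (BirthDeath.birthNeg mu) (BirthDeath.deathNeg lam)) Pm)
    (Ψ : Matrix (Fin 2) (Fin 2) (MeasureTheory.SignedMeasure ℝ))
    (hΨ : BirthDeath.IsSpectralMatrix lam mu P Ψ)
    (ψp ψm : MeasureTheory.Measure ℝ)
    (hψp : BirthDeath.IsSpectralMeasure (BirthDeath.birthPos lam) (BirthDeath.deathPos mu) Pp ψp)
    (hψm : BirthDeath.IsSpectralMeasure (BirthDeath.birthNeg mu) (BirthDeath.deathNeg lam) Pm ψm)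
    (z : ℂ) (hz : ¬ (0 ≤ z.re ∧ z.im = 0)) :
    1 - (lam (-1) : ℂ) * (mu 0 : ℂ) * BirthDeath.stieltjes z ψp * BirthDeath.stieltjes z ψm ≠ 0 ∧
    BirthDeath.signedStieltjes z (Ψ 0 0) =
      BirthDeath.stieltjes z ψp /
        (1 - (lam (-1) : ℂ) * (mu 0 : ℂ) * BirthDeath.stieltjes z ψp *
          BirthDeath.stieltjes z ψm) ∧
    (mu 0 : ℂ) / (lam (-1) : ℂ) * BirthDeath.signedStieltjes z (Ψ 1 1) =
      BirthDeath.stieltjes z ψm /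
        (1 - (lam (-1) : ℂ) * (mu 0 : ℂ) * BirthDeath.stieltjes z ψp *
          BirthDeath.stieltjes z ψm) ∧
    BirthDeath.signedStieltjes z (Ψ 0 1) =
      (lam (-1) : ℂ) * BirthDeath.stieltjes z ψp * BirthDeath.stieltjes z ψm /
        (1 - (lam (-1) : ℂ) * (mu 0 : ℂ) * BirthDeath.stieltjes z ψp *
          BirthDeath.stieltjes z ψm) := by
  open BirthDeath in
  have hfp := hψp.finite
  have hfm := hψm.finite
  have hl : (lam (-1) : ℂ) ≠ 0 := by exact_mod_cast (hlam (-1)).ne'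
  have hm : (mu 0 : ℂ) ≠ 0 := by exact_mod_cast (hmu 0).ne'
  obtain ⟨e1, e2, e3, e4⟩ := renewal_equations hlam hmu hunique hP hPp hPm
  have hmeas := hP.measurable_causalExt
  have hmp := hPp.measurable_causalExt 0 0
  have hmm := hPm.measurable_causalExt 0 0
  have hconv : ∀ {f g : ℝ → ENNReal}, Measurable f → Measurable g →
      Measurable (lconvolution f g volume) := fun hf hg => measurable_lconvolution _ hf hg
  -- the relations between the transforms at `-s`, `s > 0`
  have hpos : ∀ s : ℝ, 0 < s →
      signedStieltjes (-(s : ℂ)) (Ψ 0 0) = stieltjes (-(s : ℂ)) ψp +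
        lam (-1) * mu 0 * stieltjes (-(s : ℂ)) ψp * stieltjes (-(s : ℂ)) ψm *
          signedStieltjes (-(s : ℂ)) (Ψ 0 0) ∧
      mu 0 / lam (-1) * signedStieltjes (-(s : ℂ)) (Ψ 1 1) = stieltjes (-(s : ℂ)) ψm +
        lam (-1) * mu 0 * stieltjes (-(s : ℂ)) ψp * stieltjes (-(s : ℂ)) ψm *
          (mu 0 / lam (-1) * signedStieltjes (-(s : ℂ)) (Ψ 1 1)) ∧
      mu 0 / lam (-1) * signedStieltjes (-(s : ℂ)) (Ψ 0 1) =
        mu 0 * stieltjes (-(s : ℂ)) ψp *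
          (mu 0 / lam (-1) * signedStieltjes (-(s : ℂ)) (Ψ 1 1)) := by
    intro s hs
    have f1 := congrArg (fun f => (laplace s f).toReal) e1
    have f2 := congrArg (fun f => (laplace s f).toReal) e2
    have f3 := congrArg (fun f => (laplace s f).toReal) e3
    have f4 := congrArg (fun f => (laplace s f).toReal) e4
    have hfin := fun i j => (laplace_lt_top hs (hP.causalExt_le_heaviside i j)).ne
    have hfinp := (laplace_lt_top hs (hPp.causalExt_le_heaviside 0 0)).ne
    have hfinm := (laplace_lt_top hs (hPm.causalExt_le_heaviside 0 0)).ne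
    simp only at f1 f2 f3 f4
    rw [laplace_add hmp, laplace_smul (hconv hmp (hmeas _ _)), laplace_lconvolution hmp (hmeas _ _),
      ENNReal.toReal_add hfinp (ENNReal.mul_ne_top ENNReal.ofReal_ne_top
        (ENNReal.mul_ne_top hfinp (hfin _ _)))] at f1
    rw [laplace_smul (hconv hmm (hmeas _ _)), laplace_lconvolution hmm (hmeas _ _)] at f2
    rw [laplace_add hmm, laplace_smul (hconv hmm (hmeas _ _)), laplace_lconvolution hmm (hmeas _ _),
      ENNReal.toReal_add hfinm (ENNReal.mul_ne_top ENNReal.ofReal_ne_top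
        (ENNReal.mul_ne_top hfinm (hfin _ _)))] at f3
    rw [laplace_smul (hconv hmp (hmeas _ _)), laplace_lconvolution hmp (hmeas _ _)] at f4
    simp only [ENNReal.toReal_mul, ENNReal.toReal_ofReal (hlam (-1)).le,
      ENNReal.toReal_ofReal (hmu 0).le] at f1 f2 f3 f4
    have g0 := signedStieltjes_smul_eq_laplace hP 0 0 (κ := 1)
      (fun t ht => by rw [one_mul]; exact hΨ.apply_zero_zero ht) hs
    have g1 := signedStieltjes_smul_eq_laplace hP (-1) (-1)
      (fun t ht => hΨ.apply_neg_one_neg_one ht) hs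
    have g2 := signedStieltjes_smul_eq_laplace hP 0 (-1)
      (fun t ht => hΨ.apply_zero_neg_one ht) hs
    push_cast at g0 g1 g2
    rw [one_mul] at g0
    rw [g0, g1, g2, stieltjes_eq_laplace (fun t ht => hψp.apply_zero_zero ht) hs,
      stieltjes_eq_laplace (fun t ht => hψm.apply_zero_zero ht) hs]
    -- Elimination of the transforms of P_{-1,0} and, below, of P_{0,-1} leaves one linear equation
    -- each for those of P_00 and P_{-1,-1}.
    rw [f2] at f1
    have k4 := congrArg Complex.ofReal f4
    rw [f4] at f3
    have k1 := congrArg Complex.ofReal f1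
    have k3 := congrArg Complex.ofReal f3
    push_cast at k1 k3 k4
    exact ⟨by linear_combination k1, by linear_combination k3, by linear_combination k4⟩
  have hBp := differentiableOn_stieltjes ψp
  have hBm := differentiableOn_stieltjes ψm
  have h00 := differentiableOn_signedStieltjes (Ψ 0 0)
  have h11 := differentiableOn_signedStieltjes (Ψ 1 1)
  have h01 := differentiableOn_signedStieltjes (Ψ 0 1)
  have hw : -z ∈ Complex.slitPlane := by
    rw [Complex.mem_slitPlane_iff]
    simp only [Complex.neg_re, Complex.neg_im, ne_eq, neg_eq_zero, Left.neg_pos_iff]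
    by_contra! h
    exact hz h
  -- The relations are continued in undivided form: both sides are holomorphic on the slit plane
  -- without any knowledge of the zeros of the denominator.
  have r1 := eqOn_slitPlane_of_eq_on_pos h00 (hBp.add ((((hBp.const_mul _).mul hBm)).mul h00))
    (fun s hs => (hpos s hs).1) hw
  have r2 := eqOn_slitPlane_of_eq_on_pos (h11.const_mul _)
    (hBm.add ((((hBp.const_mul _).mul hBm)).mul (h11.const_mul _)))
    (fun s hs => (hpos s hs).2.1) hw
  have r3 := eqOn_slitPlane_of_eq_on_pos (h01.const_mul _)
    ((hBp.const_mul _).mul (h11.const_mul _)) (fun s hs => (hpos s hs).2.2) hw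
  simp only [Pi.add_apply, Pi.mul_apply, neg_neg] at r1 r2 r3
  -- At a zero of the denominator `r1` reduces to B(z; ψ⁺) = 0, which makes the denominator equal to
  -- 1.
  have hne : 1 - (lam (-1) : ℂ) * mu 0 * stieltjes z ψp * stieltjes z ψm ≠ 0 := by
    intro h
    have hp0 : stieltjes z ψp = 0 := by
      linear_combination -r1 + signedStieltjes z (Ψ 0 0) * h
    simp [hp0] at h
  have s2 : (mu 0 : ℂ) / lam (-1) * signedStieltjes z (Ψ 1 1) = stieltjes z ψm /
      (1 - (lam (-1) : ℂ) * mu 0 * stieltjes z ψp * stieltjes z ψm) := by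
    rw [eq_div_iff hne]
    linear_combination r2
  refine ⟨hne, ?_, s2, ?_⟩
  · rw [eq_div_iff hne]
    linear_combination r1
  · rw [s2] at r3
    have hml : (mu 0 : ℂ) / lam (-1) ≠ 0 := div_ne_zero hm hl
    apply mul_left_cancel₀ hml
    rw [r3]
    field_simp
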